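/- Let $\tau\in\mathbb{C}$ with $\operatorname{Im}\tau>0$, let $\alpha\in\mathbb{C}\setminus\{0\}$, $a\in\mathbb{C}$, and let $r\ge 1$ be an integer. **Notation.** Let $J=J^{(r)}_\alpha$ be the upper triangular $r\times r$ Jordan block with eigenvalue $\alpha$, and let $\xi_J$ be the flat factor of automorphy over $\mathbb{C}/(\mathbb{Z}+\tau\mathbb{Z})$ given by the representation $\xi_J(m+n\tau)=J^n$ ($m,n\in\mathbb{Z}$). A *trivialization* of $\xi_J$ is an $r\times r$ meromorphic matrix function $F$ on $\mathbb{C}$ with $\det F\not\equiv0$ and $F(u+m+n\tau)=J^nF(u)$ for all $m,n\in\mathbb{Z}$. Put $$\theta(u)=\sum_{n\in\mathbb{Z}}e^{2\pi i(n^2\tau/2+nu)},\qquad \lambda_a(u)=-\frac1{2\pi i}\,\frac{\theta'(u-a-\frac12-\frac\tau2)}{\theta(u-a-\frac12-\frac\tau2)},\qquad p_n(x)=\frac{\alpha^{-n}}{n!}\,x(x-1)\cdots(x-n+1)\quad(p_0=1),$$ let $P_r(x)$ be the upper triangular Toeplitz matrix with $(i,j)$ entry $p_{j-i}(x)$ for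 $i\le j$ and $0$ for $i>j$, and let $G_r(u)=P_r(\lambda_a(u))$. A *simple null-pole data set of size $N$* consists of $2N$ distinct points $z_1,\dots,z_N,w_1,\dots,w_N$ of the fundamental domain $\{s+t\tau: 0\le s,t<1\}$ and nonzero column vectors $\mathbf{x}_1,\dots,\mathbf{x}_N,\mathbf{y}_1,\dots,\mathbf{y}_N\in\mathbb{C}^r$. An $r\times r$ meromorphic matrix function $F$ on $\mathbb{C}$ *interpolates* it if: 1. on the fundamental domain, the divisor of $\det F$ is $z_1+\cdots+z_N-w_1-\cdots-w_N$; 2. the entries of $F$ have at most simple poles, and only at points of $w_k+\mathbb{Z}+\tau\mathbb{Z}$, $1\le k\le N$; 3. for each $k$, $F$ is analytic at the points of $z_k+\mathbb{Z}+\tau\mathbb{Z}$, and $\mathbf{x}_k$ spans the right kernel of $F$ there; 4. for each $k$, $F^{-1}$ is analytic at the points of $w_k+\mathbb{Z}+\tau\mathbb{Z}$, and $\mathbf{y}_k^\top$ spans the left kernel of $F^{-1}$ there. **Proposition.** There exist a simple null-pole data set $\mathcal{D}$ of size $N_r$ and a trivialization $F_r$ of $\xi_J$ which interpolates $\mathcal{D}$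 and has the form $F_r=G_rS_r$, where $S_r$ is an $r\times r$ meromorphic matrix function on $\mathbb{C}$ with $\det S_r\not\equiv 0$ and $S_r(u+m+n\tau)=\alpha^nS_r(u)$ for all $m,n\in\mathbb{Z}$. Here one can take $N_r=2(r-1)$ if $\alpha\in\{e^{2\pi ik\tau}:k\in\mathbb{Z}\}$ (in particular if $\alpha=1$), and $N_r=r$ if $\alpha\notin\{e^{2\pi ik\tau}:k\in\mathbb{Z}\}$. -/

import Mathlib

open Filter Topology

noncomputable section

namespace EllipticNullPole

/-! ### Meromorphic matrix functions on the complex plane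

A meromorphic function is represented by a total function `ℂ → ℂ` that is meromorphic at every
point. Its values on a discrete closed set (in particular at poles) carry no meaning, so identities
between meromorphic functions are read on a codiscrete set. -/

/-- All entries of `F` are meromorphic on `ℂ`. -/
def IsMeromorphicMatrix {r : ℕ} (F : ℂ → Matrix (Fin r) (Fin r) ℂ) : Prop :=
  ∀ i j, Meromorphic (fun u => F u i j)

/-- Nondegeneracy: `det F` is not identically zero (as a meromorphic function). -/
def IsNondegenerate {r : ℕ} (F : ℂ → Matrix (Fin r) (Fin r) ℂ) : Prop :=
  ¬ ∀ᶠ u in codiscrete ℂ, (F u).det = 0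

/-- `F` is analytic at `p` (after removing a possible removable singularity), and the value of its
analytic extension at `p` is the matrix `A`. -/
def HasAnalyticValueAt {r : ℕ} (F : ℂ → Matrix (Fin r) (Fin r) ℂ) (p : ℂ)
    (A : Matrix (Fin r) (Fin r) ℂ) : Prop :=
  ∃ H : ℂ → Matrix (Fin r) (Fin r) ℂ,
    (∀ i j, AnalyticAt ℂ (fun u => H u i j) p) ∧ (∀ᶠ u in 𝓝[≠] p, F u = H u) ∧ H p = A

/-! ### Flat factors of automorphy over `ℂ / (ℤ + τ ℤ)`

The deck group `ℤ + τ ℤ` is identified with `ℤ × ℤ`, the pair `(m, n)` acting on `ℂ` by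
`u ↦ u + m + n τ`. A flat factor of automorphy is a representation of this group. -/

/-- The normalized representation `ξ_V` with `ξ_V(1) = I`, `ξ_V(τ) = V`; thus
`ξ_V(m + n τ) = V ^ n`. -/
def flatFactor {r : ℕ} (V : GL (Fin r) ℂ) : Multiplicative (ℤ × ℤ) →* GL (Fin r) ℂ where
  toFun T := V ^ (Multiplicative.toAdd T).2
  map_one' := by simp
  map_mul' S T := by simp [zpow_add]

/-- `F` is a meromorphic matrix trivialization of the flat factor of automorphy `ξ`. -/
def IsTrivialization {r : ℕ} (τ : ℂ) (ξ : Multiplicative (ℤ × ℤ) →* GL (Fin r) ℂ)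
    (F : ℂ → Matrix (Fin r) (Fin r) ℂ) : Prop :=
  IsMeromorphicMatrix F ∧ IsNondegenerate F ∧
    ∀ m n : ℤ, ∀ᶠ u in codiscrete ℂ,
      F (u + m + n * τ) =
        (ξ (Multiplicative.ofAdd (m, n)) : Matrix (Fin r) (Fin r) ℂ) * F u

/-- The upper triangular `r × r` Jordan block with eigenvalue `α`. -/
def jordanBlock (r : ℕ) (α : ℂ) : Matrix (Fin r) (Fin r) ℂ :=
  Matrix.of fun i j =>
    if i = j then α else if (i : ℕ) + 1 = (j : ℕ) then 1 else 0

theorem det_jordanBlock (r : ℕ) (α : ℂ) : (jordanBlock r α).det = α ^ r := by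
  have h : (jordanBlock r α).BlockTriangular id := by
    intro i j hij
    have h1 : (j : ℕ) < (i : ℕ) := hij
    have h2 : i ≠ j := by rintro rfl; exact lt_irrefl _ h1
    have h3 : ¬ ((i : ℕ) + 1 = (j : ℕ)) := by omega
    simp [jordanBlock, h2, h3]
  rw [Matrix.det_of_isUpperTriangular h]
  simp [jordanBlock]

/-- The Jordan block as an invertible matrix. -/
def jordanGL (r : ℕ) (α : ℂ) (hα : α ≠ 0) : GL (Fin r) ℂ :=
  Matrix.GeneralLinearGroup.mkOfDetNeZero (jordanBlock r α)
    (by rw [det_jordanBlock]; exact pow_ne_zero r hα)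

/-! ### The matrix function `G_r = P_r(λ_a)` -/

/-- `θ(u) = ∑_{n ∈ ℤ} exp (2 π i (n² τ / 2 + n u))`. -/
def theta (τ u : ℂ) : ℂ := jacobiTheta₂ u τ

/-- `λ_a(u) = -(1 / 2 π i) θ'(u - a - 1/2 - τ/2) / θ(u - a - 1/2 - τ/2)`. -/
def lambdaFun (τ a u : ℂ) : ℂ :=
  -(1 / (2 * Real.pi * Complex.I)) *
    (deriv (theta τ) (u - a - 1 / 2 - τ / 2) / theta τ (u - a - 1 / 2 - τ / 2))

/-- `p_n(x) = (α ^ (-n) / n!) x (x - 1) ⋯ (x - (n - 1))`, with `p_0 = 1`. -/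
def pPoly (α : ℂ) (n : ℕ) (x : ℂ) : ℂ :=
  (α ^ n)⁻¹ / (n.factorial : ℂ) * ∏ k ∈ Finset.range n, (x - k)

/-- The upper triangular Toeplitz matrix `P_r(x)` with `(i, j)` entry `p_{j-i}(x)` for `i ≤ j`. -/
def PMatrix (r : ℕ) (α x : ℂ) : Matrix (Fin r) (Fin r) ℂ :=
  Matrix.of fun i j => if i ≤ j then pPoly α ((j : ℕ) - (i : ℕ)) x else 0

/-- `G_r(u) = P_r(λ_a(u))`. -/
def GMatrix (r : ℕ) (τ α a u : ℂ) : Matrix (Fin r) (Fin r) ℂ :=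
  PMatrix r α (lambdaFun τ a u)

/-- The trivialization `F` has the form `F = G_r S_r`, with `S_r` a nondegenerate meromorphic matrix
function satisfying `S_r(u + m + n τ) = α ^ n S_r(u)`. -/
def HasFormGS {r : ℕ} (τ α a : ℂ) (F : ℂ → Matrix (Fin r) (Fin r) ℂ) : Prop :=
  ∃ S : ℂ → Matrix (Fin r) (Fin r) ℂ,
    IsMeromorphicMatrix S ∧ IsNondegenerate S ∧
    (∀ m n : ℤ, ∀ᶠ u in codiscrete ℂ, S (u + m + n * τ) = α ^ n • S u) ∧
    ∀ᶠ u in codiscrete ℂ, F u = GMatrix r τ α a u * S u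

/-! ### Simple null-pole data -/

/-- The half-open fundamental parallelogram of `ℤ + τ ℤ`. -/
def fundamentalDomain (τ : ℂ) : Set ℂ :=
  {u | ∃ s t : ℝ, s ∈ Set.Ico (0 : ℝ) 1 ∧ t ∈ Set.Ico (0 : ℝ) 1 ∧ u = s + t * τ}

/-- A simple null-pole data set of size `N`: `2 N` distinct points `z_1, …, z_N, w_1, …, w_N` of the
fundamental domain, with nonzero vectors `x_1, …, x_N, y_1, …, y_N` of `ℂ ^ r`. -/
structure SimpleNullPoleData (τ : ℂ) (r N : ℕ) where
  z : Fin N → ℂ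
  w : Fin N → ℂ
  x : Fin N → Fin r → ℂ
  y : Fin N → Fin r → ℂ
  z_mem : ∀ j, z j ∈ fundamentalDomain τ
  w_mem : ∀ j, w j ∈ fundamentalDomain τ
  distinct : Function.Injective (Sum.elim z w)
  x_ne : ∀ j, x j ≠ 0
  y_ne : ∀ j, y j ≠ 0

/-- The meromorphic matrix function `F` interpolates the simple null-pole data `D`. -/
structure Interpolates {τ : ℂ} {r N : ℕ} (F : ℂ → Matrix (Fin r) (Fin r) ℂ)
    (D : SimpleNullPoleData τ r N) : Prop where
  /-- On the fundamental domain, `(det F) = z_1 + ⋯ + z_N - w_1 - ⋯ - w_N`. -/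
  det_divisor : ∀ u ∈ fundamentalDomain τ,
    meromorphicOrderAt (fun v => (F v).det) u =
      (((Nat.card {j // D.z j = u} : ℤ) - (Nat.card {j // D.w j = u} : ℤ) : ℤ) : WithTop ℤ)
  /-- The entries of `F` have at most simple poles, and only at the points `w_k + ℤ + τ ℤ`. -/
  simple_poles : ∀ i j, ∀ p : ℂ, meromorphicOrderAt (fun v => F v i j) p < 0 →
    (-1 : WithTop ℤ) ≤ meromorphicOrderAt (fun v => F v i j) p ∧
      ∃ (k : Fin N) (m n : ℤ), p = D.w k + m + n * τ
  /-- `F` is analytic at the points of `z_k + ℤ + τ ℤ`, where its right kernel is spanned by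
  `x_k`. -/
  right_kernel : ∀ (k : Fin N) (m n : ℤ), ∃ A : Matrix (Fin r) (Fin r) ℂ,
    HasAnalyticValueAt F (D.z k + m + n * τ) A ∧
      LinearMap.ker A.mulVecLin = Submodule.span ℂ {D.x k}
  /-- `F⁻¹` is analytic at the points of `w_k + ℤ + τ ℤ`, where its left kernel is spanned by
  the transpose of `y_k`. -/
  left_kernel : ∀ (k : Fin N) (m n : ℤ), ∃ B : Matrix (Fin r) (Fin r) ℂ,
    HasAnalyticValueAt (fun u => (F u)⁻¹) (D.w k + m + n * τ) B ∧
      LinearMap.ker B.vecMulLinear = Submodule.span ℂ {D.y k}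

end EllipticNullPole

end

namespace EllipticNullPole

/-! ### A theta function with simple zeros at the lattice points -/

/-! The trivialization is an explicit upper triangular matrix. Column `j` is a scalar function `h`
times the entire functions `p_l(D) σ`, `l` being the distance from the diagonal, where `D = -(2πi)⁻¹
d/du` and `σ` is a translate of `sigmaFun`. Under `u ↦ u + τ`, `σ` acquires a multiplier
proportional to `exp(-2πiu)`. Moving `D` past it replaces `D` by `D + 1`, and Pascal's rule for
`p_l` turns this shift into the Jordan block (`jordanCoeff_succ_add_tau`). The factor `h` removes
the multiplier up to `α` (`IsCompensator`).

All poles of a column come from its `h`, and the zeros and poles of the determinant are those of the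
diagonal entries `σ h`. When these points are simple and distinct, each belongs to one column, and
both kernels are lines (`exists_interpolates_of_columns`).

For `α = exp(-2πix)` with `x` outside the lattice, `h = 1/σ(u - w)` puts one pole `w` and one zero
`w - x` in each column. For `x` in the lattice these cancel. Then the first column is an exponential
without zeros or poles, and every other column has two zeros and two poles, whence `2(r - 1)`.

The factor `S_r` is `G_r⁻¹ F`, since `G_r` has determinant one and the same Jordan automorphy up to
the scalar `α`. -/

/-- The `q`-Pochhammer product `∏ (1 - q ^ n x)`, as a function of `x`. -/
noncomputable def qPochhammer (q x : ℂ) : ℂ := ∏' n : ℕ, (1 + -(q ^ n * x))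

theorem summable_norm_pow_mul {q : ℂ} (hq : ‖q‖ < 1) (x : ℂ) :
    Summable fun n : ℕ => ‖-(q ^ n * x)‖ := by
  simpa using (summable_geometric_of_lt_one (norm_nonneg _) hq).mul_right ‖x‖

theorem qPochhammer_eq {q : ℂ} (hq : ‖q‖ < 1) (x : ℂ) :
    qPochhammer q x = (1 - x) * qPochhammer q (q * x) := by
  unfold qPochhammer
  rw [tprod_eq_zero_mul']
  · congr 1
    · simp [sub_eq_add_neg]
    · refine tprod_congr fun n => ?_
      ring
  · have := multipliable_one_add_of_summable (summable_norm_pow_mul hq (q * x))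
    refine this.congr fun n => ?_
    ring

theorem qPochhammer_ne_zero {q : ℂ} (hq : ‖q‖ < 1) {x : ℂ} (hx : ∀ n : ℕ, q ^ n * x ≠ 1) :
    qPochhammer q x ≠ 0 := by
  refine tprod_one_add_ne_zero_of_summable (fun n h => hx n ?_) (summable_norm_pow_mul hq x)
  linear_combination -h

theorem differentiable_qPochhammer {q : ℂ} (hq : ‖q‖ < 1) : Differentiable ℂ (qPochhammer q) := by
  intro x
  have hx : x ∈ Metric.ball (0 : ℂ) (‖x‖ + 1) := by simp
  refine DifferentiableOn.differentiableAt (s := Metric.ball (0 : ℂ) (‖x‖ + 1)) ?_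
    (Metric.isOpen_ball.mem_nhds hx)
  have key := ((summable_geometric_of_lt_one (norm_nonneg _) hq).mul_right
    (‖x‖ + 1)).hasProdLocallyUniformlyOn_nat_one_add (f := fun (n : ℕ) (y : ℂ) => -(q ^ n * y))
    (K := Metric.ball (0 : ℂ) (‖x‖ + 1)) Metric.isOpen_ball
    (.of_forall fun n y hy => by
      rw [norm_neg, norm_mul, norm_pow]
      gcongr
      simpa using (Metric.mem_ball.1 hy).le) (fun n => by fun_prop)
  exact key.differentiableOn (.of_forall fun _ => by
    simpa [Finset.prod_fn] using
      DifferentiableOn.finsetProd (fun _ _ => by fun_prop)) Metric.isOpen_ball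

/-- The nome-squared `exp (2 π i τ)`. -/
noncomputable def nome (τ : ℂ) : ℂ := Complex.exp (2 * Real.pi * Complex.I * τ)

theorem norm_nome_lt_one {τ : ℂ} (hτ : 0 < τ.im) : ‖nome τ‖ < 1 := by
  rw [nome, Complex.norm_exp, Real.exp_lt_one_iff]
  have := mul_pos (mul_pos two_pos Real.pi_pos) hτ
  simp
  linarith

/-- An entire function with simple zeros exactly at the points of `ℤ + τ ℤ`, given as a product. -/
noncomputable def sigmaFun (τ u : ℂ) : ℂ :=
  qPochhammer (nome τ) (Complex.exp (2 * Real.pi * Complex.I * u)) *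
    qPochhammer (nome τ) (nome τ * Complex.exp (-(2 * Real.pi * Complex.I * u)))

theorem differentiable_sigmaFun {τ : ℂ} (hτ : 0 < τ.im) : Differentiable ℂ (sigmaFun τ) := by
  have h := differentiable_qPochhammer (norm_nome_lt_one hτ)
  exact (h.comp (by fun_prop : Differentiable ℂ fun u : ℂ =>
    Complex.exp (2 * Real.pi * Complex.I * u))).mul (h.comp (by fun_prop : Differentiable ℂ
      fun u : ℂ => nome τ * Complex.exp (-(2 * Real.pi * Complex.I * u))))

theorem sigmaFun_add_one (τ u : ℂ) : sigmaFun τ (u + 1) = sigmaFun τ u := by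
  have h : Complex.exp (2 * Real.pi * Complex.I * (u + 1)) =
      Complex.exp (2 * Real.pi * Complex.I * u) := by
    rw [mul_add, mul_one, Complex.exp_add, Complex.exp_two_pi_mul_I, mul_one]
  simp only [sigmaFun, Complex.exp_neg, h]

/-- With `x = exp(2πiu)`, the shift moves the factor `1 - x` out of one product and `1 - x⁻¹` into
the other; their ratio gives `-x⁻¹`. -/
theorem sigmaFun_add_tau {τ : ℂ} (hτ : 0 < τ.im) (u : ℂ) :
    sigmaFun τ (u + τ) = -Complex.exp (-(2 * Real.pi * Complex.I * u)) * sigmaFun τ u := by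
  have hq := norm_nome_lt_one hτ
  have hq0 : nome τ ≠ 0 := Complex.exp_ne_zero _
  have h : Complex.exp (2 * Real.pi * Complex.I * (u + τ)) =
      nome τ * Complex.exp (2 * Real.pi * Complex.I * u) := by
    rw [mul_add, Complex.exp_add, nome, mul_comm]
  simp only [sigmaFun, Complex.exp_neg, h]
  have hx := Complex.exp_ne_zero (2 * Real.pi * Complex.I * u)
  set x := Complex.exp (2 * Real.pi * Complex.I * u)
  have e : nome τ * (nome τ * x)⁻¹ = x⁻¹ := by field_simp
  rw [e, qPochhammer_eq hq x, qPochhammer_eq hq x⁻¹]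
  field_simp
  ring

/-- The indicator function of the lattice `ℤ + τ ℤ`. -/
noncomputable def latticeOrd (τ u : ℂ) : ℤ := by
  classical exact if ∃ m n : ℤ, u = m + n * τ then 1 else 0

theorem latticeOrd_of_mem {τ u : ℂ} (h : ∃ m n : ℤ, u = m + n * τ) : latticeOrd τ u = 1 :=
  if_pos h

theorem latticeOrd_of_notMem {τ u : ℂ} (h : ¬ ∃ m n : ℤ, u = m + n * τ) : latticeOrd τ u = 0 :=
  if_neg h

theorem latticeOrd_nonneg (τ u : ℂ) : 0 ≤ latticeOrd τ u := by
  by_cases h : ∃ m n : ℤ, u = m + n * τ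
  · simp [latticeOrd_of_mem h]
  · simp [latticeOrd_of_notMem h]

theorem latticeOrd_add (τ u : ℂ) (m n : ℤ) : latticeOrd τ (u + m + n * τ) = latticeOrd τ u := by
  by_cases h : ∃ m n : ℤ, u = m + n * τ
  · rw [latticeOrd_of_mem h, latticeOrd_of_mem]
    obtain ⟨a, b, rfl⟩ := h
    exact ⟨a + m, b + n, by push_cast; ring⟩
  · rw [latticeOrd_of_notMem h, latticeOrd_of_notMem]
    rintro ⟨a, b, e⟩
    exact h ⟨a - m, b - n, by push_cast; linear_combination e⟩

theorem nome_pow_mul_exp_eq_one {τ u : ℂ} {n : ℕ}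
    (h : nome τ ^ n * Complex.exp (2 * Real.pi * Complex.I * u) = 1) :
    ∃ m : ℤ, u = m - n * τ := by
  rw [nome, ← Complex.exp_nat_mul, ← Complex.exp_add, Complex.exp_eq_one_iff] at h
  obtain ⟨m, hm⟩ := h
  refine ⟨m, ?_⟩
  have := Complex.two_pi_I_ne_zero
  apply mul_left_cancel₀ this
  linear_combination hm

/-- The two products vanish on complementary parts of the lattice: the first where the coefficient
of `τ` is at most `0`, the second where it is at least `1`. -/
theorem sigmaFun_ne_zero {τ : ℂ} (hτ : 0 < τ.im) {u : ℂ} (hu : ¬ ∃ m n : ℤ, u = m + n * τ) :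
    sigmaFun τ u ≠ 0 := by
  refine mul_ne_zero (qPochhammer_ne_zero (norm_nome_lt_one hτ) fun n h => hu ?_)
    (qPochhammer_ne_zero (norm_nome_lt_one hτ) fun n h => hu ?_)
  · obtain ⟨m, hm⟩ := nome_pow_mul_exp_eq_one h
    exact ⟨m, -n, by push_cast; linear_combination hm⟩
  · rw [← mul_assoc, ← pow_succ, ← mul_neg] at h
    obtain ⟨m, hm⟩ := nome_pow_mul_exp_eq_one h
    exact ⟨-m, n + 1, by push_cast at hm ⊢; linear_combination -hm⟩

/-- Only the factor `1 - exp(2πiu)` vanishes at `0`, to first order; the cofactor there is the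
square of `∏ (1 - q^(n+1))`, which is nonzero. -/
theorem meromorphicOrderAt_sigmaFun_zero {τ : ℂ} (hτ : 0 < τ.im) :
    meromorphicOrderAt (sigmaFun τ) 0 = 1 := by
  have hq := norm_nome_lt_one hτ
  have hqz : qPochhammer (nome τ) (nome τ) ≠ 0 := qPochhammer_ne_zero hq fun n h => by
    have : ‖nome τ ^ (n + 1)‖ = 1 := by rw [pow_succ, h, norm_one]
    rw [norm_pow] at this
    exact (pow_lt_one₀ (norm_nonneg _) hq (Nat.succ_ne_zero n)).ne this
  have hd := differentiable_qPochhammer hq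
  have hg : Differentiable ℂ fun u : ℂ =>
      qPochhammer (nome τ) (nome τ * Complex.exp (2 * Real.pi * Complex.I * u)) *
      qPochhammer (nome τ) (nome τ * Complex.exp (-(2 * Real.pi * Complex.I * u))) :=
    (hd.comp (by fun_prop : Differentiable ℂ fun u : ℂ =>
      nome τ * Complex.exp (2 * Real.pi * Complex.I * u))).mul (hd.comp (by fun_prop :
      Differentiable ℂ fun u : ℂ => nome τ * Complex.exp (-(2 * Real.pi * Complex.I * u))))
  have he : sigmaFun τ = (fun u : ℂ =>
      qPochhammer (nome τ) (nome τ * Complex.exp (2 * Real.pi * Complex.I * u)) *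
      qPochhammer (nome τ) (nome τ * Complex.exp (-(2 * Real.pi * Complex.I * u)))) *
      fun u : ℂ => 1 - Complex.exp (2 * Real.pi * Complex.I * u) := by
    ext u
    simp only [sigmaFun, Pi.mul_apply]
    rw [qPochhammer_eq hq (Complex.exp (2 * Real.pi * Complex.I * u))]
    ring
  have hd1 : HasDerivAt (fun u : ℂ => 1 - Complex.exp (2 * Real.pi * Complex.I * u))
      (-(2 * Real.pi * Complex.I)) 0 := by
    have h1 : HasDerivAt (fun u : ℂ => 2 * Real.pi * Complex.I * u)
      (2 * Real.pi * Complex.I) 0 := by simpa using (hasDerivAt_id (0 : ℂ)).const_mul _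
    simpa using h1.cexp.const_sub 1
  have ha : AnalyticAt ℂ (fun u : ℂ => 1 - Complex.exp (2 * Real.pi * Complex.I * u)) 0 := by
    fun_prop
  rw [he, meromorphicOrderAt_mul_of_ne_zero (hg.analyticAt 0) (by simpa using hqz),
    ha.meromorphicOrderAt_eq]
  have h1 := ha.analyticOrderAt_sub_eq_one_of_deriv_ne_zero
    (by rw [hd1.deriv]; exact neg_ne_zero.2 Complex.two_pi_I_ne_zero)
  simp only [mul_zero, Complex.exp_zero, sub_self, sub_zero] at h1
  rw [h1]; rfl

theorem meromorphicOrderAt_sigmaFun_add_tau {τ : ℂ} (hτ : 0 < τ.im) (u : ℂ) :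
    meromorphicOrderAt (sigmaFun τ) (u + τ) = meromorphicOrderAt (sigmaFun τ) u := by
  rw [← meromorphicOrderAt_comp_add_const_eq_meromorphicOrderAt]
  have : sigmaFun τ ∘ (· + τ) =
      (fun u => -Complex.exp (-(2 * Real.pi * Complex.I * u))) * sigmaFun τ := by
    ext v
    exact sigmaFun_add_tau hτ v
  rw [this, meromorphicOrderAt_mul_of_ne_zero
    (g := fun u => -Complex.exp (-(2 * Real.pi * Complex.I * u))) (by fun_prop)
    (neg_ne_zero.2 (Complex.exp_ne_zero _))]

theorem meromorphicOrderAt_sigmaFun_add_one (τ u : ℂ) :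
    meromorphicOrderAt (sigmaFun τ) (u + 1) = meromorphicOrderAt (sigmaFun τ) u := by
  rw [← meromorphicOrderAt_comp_add_const_eq_meromorphicOrderAt]
  congr 1
  ext v
  exact sigmaFun_add_one τ v

theorem apply_add_int_mul_of_periodic {X : Type*} {f : ℂ → X} {c : ℂ} (h : ∀ u, f (u + c) = f u)
    (u : ℂ) (n : ℤ) : f (u + n * c) = f u := by
  have : Function.Periodic f c := h
  exact this.int_mul n u

theorem meromorphicOrderAt_sigmaFun {τ : ℂ} (hτ : 0 < τ.im) (u : ℂ) :
    meromorphicOrderAt (sigmaFun τ) u = (latticeOrd τ u : WithTop ℤ) := by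
  by_cases h : ∃ m n : ℤ, u = m + n * τ
  · rw [latticeOrd_of_mem h]
    obtain ⟨m, n, rfl⟩ := h
    rw [apply_add_int_mul_of_periodic (meromorphicOrderAt_sigmaFun_add_tau hτ)]
    have := apply_add_int_mul_of_periodic (meromorphicOrderAt_sigmaFun_add_one τ) 0 m
    rw [zero_add, mul_one] at this
    rw [this, meromorphicOrderAt_sigmaFun_zero hτ]; rfl
  · have ha := (differentiable_sigmaFun hτ).analyticAt u
    rw [latticeOrd_of_notMem h, ha.meromorphicOrderAt_eq,
      ha.analyticOrderAt_eq_zero.2 (sigmaFun_ne_zero hτ h)]; rfl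

/-! ### Theta is not identically zero -/

/-- The constant Fourier coefficient of theta on `[0, 1]` is `1`. This is all that is needed about
the zeros of theta, which enters only through `λ_a`. -/
theorem exists_theta_ne_zero {τ : ℂ} (hτ : 0 < τ.im) : ∃ u, theta τ u ≠ 0 := by
  by_contra! hc
  let f : ℤ → C(ℝ, ℂ) := fun n => ⟨fun x : ℝ => jacobiTheta₂_term n x τ, by
    unfold jacobiTheta₂_term; fun_prop⟩
  have hf (n : ℤ) (x : ℝ) : f n x = Complex.exp (Real.pi * Complex.I * n ^ 2 * τ) *
      Complex.exp (2 * Real.pi * Complex.I * n * x) := by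
    simp only [f, ContinuousMap.coe_mk]
    rw [jacobiTheta₂_term, Complex.exp_add, mul_comm]
  have hnorm : Summable fun n : ℤ =>
      ‖(f n).restrict (⟨Set.uIcc 0 1, isCompact_uIcc⟩ : TopologicalSpace.Compacts ℝ)‖ := by
    refine Summable.of_nonneg_of_le (fun n => norm_nonneg _) (fun n => ?_)
      ((summable_jacobiTheta₂_term_iff 0 τ).2 hτ).norm
    refine (ContinuousMap.norm_le _ (norm_nonneg _)).2 fun x => le_of_eq ?_
    simp only [ContinuousMap.restrict_apply, f, ContinuousMap.coe_mk]
    rw [norm_jacobiTheta₂_term, norm_jacobiTheta₂_term]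
    simp
  have hsum := intervalIntegral.hasSum_intervalIntegral_of_summable_norm hnorm
  have hint (n : ℤ) : ∫ x in (0 : ℝ)..1, f n x = if n = 0 then 1 else 0 := by
    simp only [hf, intervalIntegral.integral_const_mul]
    split_ifs with hn
    · simp [hn]
    · rw [integral_exp_mul_complex (by simp [hn, Real.pi_ne_zero])]
      have : Complex.exp (2 * Real.pi * Complex.I * n) = 1 := by
        rw [mul_comm]; exact Complex.exp_int_mul_two_pi_mul_I n
      simp [this]
  have hzero (x : ℝ) : ∑' n, f n x = 0 := hc x
  simp only [hint, hzero, intervalIntegral.integral_zero] at hsum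
  exact one_ne_zero ((hasSum_ite_eq (0 : ℤ) (1 : ℂ)).unique hsum)

theorem differentiable_theta {τ : ℂ} (hτ : 0 < τ.im) : Differentiable ℂ (theta τ) := fun u =>
  differentiableAt_jacobiTheta₂_fst u hτ

theorem eventually_theta_ne_zero {τ : ℂ} (hτ : 0 < τ.im) (c : ℂ) :
    ∀ᶠ u in codiscrete ℂ, theta τ (u - c) ≠ 0 := by
  obtain ⟨u, hu⟩ := exists_theta_ne_zero hτ
  have ha : AnalyticOnNhd ℂ (fun u => theta τ (u - c)) Set.univ := fun v _ =>
    ((differentiable_theta hτ).comp (by fun_prop : Differentiable ℂ fun u => u - c)).analyticAt v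
  exact ha.preimage_zero_mem_codiscrete (x := u + c) (by simpa using hu)

/-! ### The function `λ_a` -/

theorem lambdaFun_add_one (τ a u : ℂ) : lambdaFun τ a (u + 1) = lambdaFun τ a u := by
  have h (v : ℂ) : theta τ (v + 1) = theta τ v := jacobiTheta₂_add_left v τ
  have h' (v : ℂ) : deriv (theta τ) (v + 1) = deriv (theta τ) v := by
    rw [← deriv_comp_add_const]; congr 1; ext w; exact h w
  have e : u + 1 - a - 1 / 2 - τ / 2 = (u - a - 1 / 2 - τ / 2) + 1 := by ring
  rw [lambdaFun, lambdaFun, e, h, h']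

/-- The theta multiplier has logarithmic derivative `-2πi`, normalized to `1` in `λ_a`. At zeros of
theta the quotient has a conventional value, so they are excluded. -/
theorem lambdaFun_add_tau {τ : ℂ} (hτ : 0 < τ.im) {a u : ℂ}
    (hu : theta τ (u - a - 1 / 2 - τ / 2) ≠ 0) :
    lambdaFun τ a (u + τ) = lambdaFun τ a u + 1 := by
  have h (v : ℂ) : theta τ (v + τ) =
      Complex.exp (-Real.pi * Complex.I * (τ + 2 * v)) * theta τ v := jacobiTheta₂_add_left' v τ
  have h' (v : ℂ) : deriv (theta τ) (v + τ) = Complex.exp (-Real.pi * Complex.I * (τ + 2 * v)) *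
      (deriv (theta τ) v - 2 * Real.pi * Complex.I * theta τ v) := by
    rw [← deriv_comp_add_const, funext h]
    have h1 : HasDerivAt (fun v : ℂ => -Real.pi * Complex.I * (τ + 2 * v))
        (-Real.pi * Complex.I * 2) v := by
      simpa using (((hasDerivAt_id v).const_mul 2).const_add τ).const_mul (-Real.pi * Complex.I)
    rw [(h1.cexp.fun_mul ((differentiable_theta hτ) v).hasDerivAt).deriv]
    ring
  have e : u + τ - a - 1 / 2 - τ / 2 = (u - a - 1 / 2 - τ / 2) + τ := by ring
  have hE := Complex.exp_ne_zero (-Real.pi * Complex.I * (τ + 2 * (u - a - 1 / 2 - τ / 2)))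
  have hp := Complex.two_pi_I_ne_zero
  rw [lambdaFun, lambdaFun, e, h, h', mul_div_mul_left _ _ hE, sub_div, mul_div_cancel_right₀ _ hu]
  field_simp
  ring

theorem meromorphic_lambdaFun {τ : ℂ} (hτ : 0 < τ.im) (a : ℂ) : Meromorphic (lambdaFun τ a) := by
  intro u
  have ha : AnalyticAt ℂ (theta τ) (u - a - 1 / 2 - τ / 2) :=
    (differentiable_theta hτ).analyticAt _
  have hs : AnalyticAt ℂ (fun u : ℂ => u - a - 1 / 2 - τ / 2) u := by fun_prop
  have h1 : AnalyticAt ℂ (fun u : ℂ => theta τ (u - a - 1 / 2 - τ / 2)) u := ha.comp_of_eq hs rfl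
  have h2 : AnalyticAt ℂ (fun u : ℂ => deriv (theta τ) (u - a - 1 / 2 - τ / 2)) u :=
    ha.deriv.comp_of_eq hs rfl
  exact analyticAt_const.meromorphicAt.mul (h2.meromorphicAt.div h1.meromorphicAt)

/-! ### The matrix function `G_r` -/

theorem pPoly_succ (α : ℂ) (n : ℕ) (x : ℂ) :
    pPoly α (n + 1) x = (x - n) / (α * (n + 1)) * pPoly α n x := by
  rw [pPoly, pPoly, Finset.prod_range_succ, Nat.factorial_succ, pow_succ]
  push_cast
  simp only [div_eq_mul_inv, mul_inv]
  ring

/-- This is Pascal's rule, as `p_n(x)` is `α⁻ⁿ` times the binomial coefficient of `x` over `n`. -/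
theorem pPoly_succ_add_one {α : ℂ} (hα : α ≠ 0) (n : ℕ) (x : ℂ) :
    α * pPoly α (n + 1) (x + 1) = α * pPoly α (n + 1) x + pPoly α n x := by
  induction n with
  | zero => simp [pPoly]; field_simp
  | succ n ih =>
    have h1 : (n : ℂ) + 1 ≠ 0 := Nat.cast_add_one_ne_zero n
    have h2 : (n : ℂ) + 1 + 1 ≠ 0 := by exact_mod_cast Nat.succ_ne_zero (n + 1)
    have hs := pPoly_succ α n x
    rw [pPoly_succ α (n + 1), pPoly_succ α (n + 1)]
    have e : pPoly α (n + 1) (x + 1) = pPoly α (n + 1) x + pPoly α n x / α := by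
      field_simp; linear_combination ih
    rw [e, hs]
    push_cast
    field_simp
    ring

theorem jordanBlock_mul_apply {r : ℕ} (α : ℂ) (A : Matrix (Fin r) (Fin r) ℂ) (i j : Fin r) :
    (jordanBlock r α * A) i j =
      α * A i j + if h : (i : ℕ) + 1 < r then A ⟨i + 1, h⟩ j else 0 := by
  rw [Matrix.mul_apply]
  have : ∀ k, jordanBlock r α i k * A k j = (if i = k then α * A k j else 0) +
      if (i : ℕ) + 1 = (k : ℕ) then A k j else 0 := by
    intro k
    simp only [jordanBlock, Matrix.of_apply]
    by_cases h : i = k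
    · subst h; simp
    · simp [h]
  simp only [this, Finset.sum_add_distrib, Finset.sum_ite_eq, Finset.mem_univ, if_true]
  congr 1
  split_ifs with h
  · rw [Finset.sum_eq_single ⟨i + 1, h⟩]
    · simp
    · intro b _ hb
      rw [if_neg]
      intro e
      exact hb (Fin.ext e.symm)
    · simp
  · refine Finset.sum_eq_zero fun k _ => if_neg fun e => h ?_
    rw [e]; exact k.2

/-- The matrix with `(i, j)` entry `c j (j - i)` for `i ≤ j` and `0` below the diagonal. -/
def upperOf (r : ℕ) (c : Fin r → ℕ → ℂ) : Matrix (Fin r) (Fin r) ℂ :=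
  Matrix.of fun i j => if i ≤ j then c j ((j : ℕ) - (i : ℕ)) else 0

/-- The scalar `β` lets one computation serve both `G_r` (`β = α`) and the trivialization (`β = 1`).
-/
theorem jordanBlock_mul_upperOf {r : ℕ} {α β : ℂ} {c d : Fin r → ℕ → ℂ}
    (h0 : ∀ j, β * d j 0 = α * c j 0)
    (h1 : ∀ (j : Fin r) l, l + 1 ≤ (j : ℕ) → β * d j (l + 1) = α * c j (l + 1) + c j l) :
    jordanBlock r α * upperOf r c = β • upperOf r d := by
  ext i j
  rw [jordanBlock_mul_apply, Matrix.smul_apply, smul_eq_mul]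
  simp only [upperOf, Matrix.of_apply]
  rcases lt_trichotomy i j with hij | rfl | hij
  · have h2 : (i : ℕ) + 1 ≤ j := hij
    have h3 : (i : ℕ) + 1 < r := h2.trans_lt j.2
    have h4 : (⟨i + 1, h3⟩ : Fin r) ≤ j := h2
    rw [if_pos hij.le, if_pos hij.le, dif_pos h3, if_pos h4]
    obtain ⟨l, hl⟩ := Nat.exists_eq_add_of_le h2
    have e1 : (j : ℕ) - i = l + 1 := by omega
    have e2 : (j : ℕ) - ((⟨i + 1, h3⟩ : Fin r) : ℕ) = l := by simp; omega
    rw [e1, e2, h1 j l (by omega)]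
  · have h4 : ∀ h3, ¬ (⟨i + 1, h3⟩ : Fin r) ≤ i := fun h3 h => by
      have : (i : ℕ) + 1 ≤ i := h
      omega
    simp [h4, h0]
  · have h4 : ∀ h3, ¬ (⟨i + 1, h3⟩ : Fin r) ≤ j := fun h3 h => by
      have h5 : (i : ℕ) + 1 ≤ j := h
      have h6 : (j : ℕ) < i := hij
      omega
    simp [h4, hij.not_ge]

theorem det_upperOf (r : ℕ) (c : Fin r → ℕ → ℂ) : (upperOf r c).det = ∏ j, c j 0 := by
  rw [Matrix.det_of_isUpperTriangular]
  · simp [upperOf]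
  · intro i j hij
    have : ¬ i ≤ j := not_le_of_gt hij
    simp [upperOf, this]

theorem GMatrix_eq_upperOf (r : ℕ) (τ α a u : ℂ) :
    GMatrix r τ α a u = upperOf r fun _ l => pPoly α l (lambdaFun τ a u) := rfl

theorem det_GMatrix (r : ℕ) (τ α a u : ℂ) : (GMatrix r τ α a u).det = 1 := by
  rw [GMatrix_eq_upperOf, det_upperOf]
  simp [pPoly]

theorem GMatrix_add_one (r : ℕ) (τ α a u : ℂ) :
    GMatrix r τ α a (u + 1) = GMatrix r τ α a u := by
  rw [GMatrix, lambdaFun_add_one, GMatrix]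

theorem GMatrix_add_tau (r : ℕ) {τ α a u : ℂ} (hτ : 0 < τ.im) (hα : α ≠ 0)
    (hu : theta τ (u - a - 1 / 2 - τ / 2) ≠ 0) :
    jordanBlock r α * GMatrix r τ α a u = α • GMatrix r τ α a (u + τ) := by
  rw [GMatrix_eq_upperOf, GMatrix_eq_upperOf, lambdaFun_add_tau hτ hu]
  exact jordanBlock_mul_upperOf (fun j => by simp [pPoly])
    fun j l _ => pPoly_succ_add_one hα l _

theorem isMeromorphicMatrix_upperOf {r : ℕ} {c : Fin r → ℕ → ℂ → ℂ}
    (hc : ∀ (j : Fin r) l, l ≤ (j : ℕ) → Meromorphic (c j l)) :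
    IsMeromorphicMatrix fun u => upperOf r fun j l => c j l u := by
  intro i j
  simp only [upperOf, Matrix.of_apply]
  split_ifs
  · exact hc j _ (Nat.sub_le _ _)
  · exact fun x => MeromorphicAt.const 0 x

theorem isMeromorphicMatrix_GMatrix (r : ℕ) {τ : ℂ} (hτ : 0 < τ.im) (α a : ℂ) :
    IsMeromorphicMatrix (GMatrix r τ α a) := by
  refine isMeromorphicMatrix_upperOf (c := fun _ l u => pPoly α l (lambdaFun τ a u))
    fun j l _ => ?_
  have := meromorphic_lambdaFun hτ a
  unfold pPoly
  fun_prop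

/-! ### Quasi-periodicity -/

/-- Stated for a group action so as to cover both the Jordan block acting on `F` and the scalar `α`
acting on `S`. The invariant predicate `p` keeps the orbit away from the zeros of theta. -/
theorem apply_add_int_mul_eq_zpow_smul {𝒢 X : Type*} [Group 𝒢] [MulAction 𝒢 X] {f : ℂ → X} {c : ℂ}
    {g : 𝒢} {p : ℂ → Prop} (hp : ∀ u, p (u + c) = p u) (h : ∀ u, p u → f (u + c) = g • f u)
    {u : ℂ} (hu : p u) (n : ℤ) : f (u + n * c) = g ^ n • f u := by
  have hpn (n : ℤ) : p (u + n * c) := by rwa [apply_add_int_mul_of_periodic hp]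
  induction n with
  | zero => simp
  | succ n ih =>
    have e : u + ((n : ℤ) + 1 : ℤ) * c = u + (n : ℤ) * c + c := by push_cast; ring
    rw [e, h _ (hpn n), ih, ← mul_smul, zpow_add_one, ← (Commute.self_zpow g n).eq]
  | pred n ih =>
    have e : u + (-(n : ℤ) : ℤ) * c = u + (-(n : ℤ) - 1 : ℤ) * c + c := by push_cast; ring
    rw [e, h _ (hpn _)] at ih
    rw [← inv_smul_eq_iff.2 ih.symm, ← mul_smul, zpow_sub_one,
      ← ((Commute.refl g).inv_left.zpow_right _).eq]

/-! ### Analytic and meromorphic matrix functions -/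

theorem analyticAt_det {r : ℕ} {H : ℂ → Matrix (Fin r) (Fin r) ℂ} {p : ℂ}
    (hH : ∀ i j, AnalyticAt ℂ (fun u => H u i j) p) : AnalyticAt ℂ (fun u => (H u).det) p := by
  simp only [Matrix.det_apply']
  exact Finset.analyticAt_fun_sum _ fun σ _ =>
    analyticAt_const.mul (Finset.analyticAt_fun_prod _ fun i _ => hH _ _)

theorem analyticAt_adjugate {r : ℕ} {H : ℂ → Matrix (Fin r) (Fin r) ℂ} {p : ℂ}
    (hH : ∀ i j, AnalyticAt ℂ (fun u => H u i j) p) (i j : Fin r) :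
    AnalyticAt ℂ (fun u => (H u).adjugate i j) p := by
  simp only [Matrix.adjugate_apply]
  refine analyticAt_det fun k l => ?_
  simp only [Matrix.updateRow_apply]
  split_ifs
  · exact analyticAt_const
  · exact hH k l

theorem analyticAt_inv {r : ℕ} {H : ℂ → Matrix (Fin r) (Fin r) ℂ} {p : ℂ}
    (hH : ∀ i j, AnalyticAt ℂ (fun u => H u i j) p) (hp : (H p).det ≠ 0) (i j : Fin r) :
    AnalyticAt ℂ (fun u => (H u)⁻¹ i j) p := by
  simp only [Matrix.inv_def, Matrix.smul_apply, Ring.inverse_eq_inv', smul_eq_mul]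
  exact ((analyticAt_det hH).inv hp).mul (analyticAt_adjugate hH i j)

theorem IsMeromorphicMatrix.det {r : ℕ} {F : ℂ → Matrix (Fin r) (Fin r) ℂ}
    (hF : IsMeromorphicMatrix F) : Meromorphic fun u => (F u).det := by
  intro x
  simp only [Matrix.det_apply']
  exact MeromorphicAt.fun_sum fun σ _ =>
    (MeromorphicAt.const _ x).fun_mul (MeromorphicAt.fun_prod fun i _ => hF _ _ x)

theorem IsMeromorphicMatrix.adjugate {r : ℕ} {F : ℂ → Matrix (Fin r) (Fin r) ℂ}
    (hF : IsMeromorphicMatrix F) : IsMeromorphicMatrix fun u => (F u).adjugate := by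
  intro i j
  simp only [Matrix.adjugate_apply]
  refine IsMeromorphicMatrix.det fun k l => ?_
  simp only [Matrix.updateRow_apply]
  split_ifs
  · exact fun x => MeromorphicAt.const _ x
  · exact hF k l

theorem IsMeromorphicMatrix.mul {r : ℕ} {F G : ℂ → Matrix (Fin r) (Fin r) ℂ}
    (hF : IsMeromorphicMatrix F) (hG : IsMeromorphicMatrix G) :
    IsMeromorphicMatrix fun u => F u * G u := by
  intro i j x
  simp only [Matrix.mul_apply]
  exact MeromorphicAt.fun_sum fun k _ => (hF i k x).fun_mul (hG k j x)

theorem exists_analyticAt_eventuallyEq {f : ℂ → ℂ} {p : ℂ} (hf : MeromorphicAt f p)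
    (h0 : 0 ≤ meromorphicOrderAt f p) : ∃ g, AnalyticAt ℂ g p ∧ f =ᶠ[𝓝[≠] p] g :=
  ⟨toMeromorphicNFAt f p, by
    have h : MeromorphicNFAt (toMeromorphicNFAt f p) p := meromorphicNFAt_toMeromorphicNFAt
    rwa [← h.meromorphicOrderAt_nonneg_iff_analyticAt, ← meromorphicOrderAt_congr
      (hf.eq_nhdsNE_toMeromorphicNFAt)], hf.eq_nhdsNE_toMeromorphicNFAt⟩

theorem exists_analyticAt_matrix {r : ℕ} {F : ℂ → Matrix (Fin r) (Fin r) ℂ} {p : ℂ}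
    (hF : ∀ i j, MeromorphicAt (fun u => F u i j) p)
    (h0 : ∀ i j, 0 ≤ meromorphicOrderAt (fun u => F u i j) p) :
    ∃ H : ℂ → Matrix (Fin r) (Fin r) ℂ, (∀ i j, AnalyticAt ℂ (fun u => H u i j) p) ∧
      ∀ᶠ u in 𝓝[≠] p, F u = H u := by
  choose g hg hfg using fun i j => exists_analyticAt_eventuallyEq (hF i j) (h0 i j)
  refine ⟨fun u => Matrix.of fun i j => g i j u, hg, ?_⟩
  filter_upwards [eventually_all.2 fun i => eventually_all.2 fun j => hfg i j] with u hu
  ext i j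
  exact hu i j

theorem meromorphicOrderAt_eq_zero_iff_ne_zero {g : ℂ → ℂ} {p : ℂ} (hg : AnalyticAt ℂ g p) :
    meromorphicOrderAt g p = 0 ↔ g p ≠ 0 := by
  rw [← hg.analyticOrderAt_eq_zero, hg.meromorphicOrderAt_eq]
  cases h : analyticOrderAt g p with
  | top => simp
  | coe n => simp

/-! ### Kernels -/

/-- Back substitution from the last row shows that a kernel vector is determined by its `k`-th
coordinate, so the kernel is at most a line; the vanishing determinant makes it nonzero. -/
theorem exists_ker_mulVecLin_eq_span {r : ℕ} {A : Matrix (Fin r) (Fin r) ℂ}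
    (hA : ∀ i j, j < i → A i j = 0) {k : Fin r} (hk : A k k = 0) (hd : ∀ j, j ≠ k → A j j ≠ 0) :
    ∃ x : Fin r → ℂ, x ≠ 0 ∧ LinearMap.ker A.mulVecLin = Submodule.span ℂ {x} := by
  have hdet : A.det = 0 := by
    rw [Matrix.det_of_isUpperTriangular fun i j hij => hA i j hij]
    exact Finset.prod_eq_zero (Finset.mem_univ k) hk
  obtain ⟨x, hx0, hx⟩ := Matrix.exists_mulVec_eq_zero_iff.2 hdet
  have key : ∀ v : Fin r → ℂ, A.mulVec v = 0 → v k = 0 → v = 0 := by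
    intro v hv hvk
    ext i
    induction i using WellFoundedGT.induction with
    | _ i ih =>
      by_cases hik : i = k
      · rw [hik]; exact hvk
      · have h := congrFun hv i
        rw [Matrix.mulVec, dotProduct, Finset.sum_eq_single i] at h
        · exact (mul_eq_zero.1 h).resolve_left (hd i hik)
        · intro j _ hj
          rcases lt_or_gt_of_ne hj with hj | hj
          · rw [hA i j hj, zero_mul]
          · rw [ih j hj]; simp
        · simp
  have hxk : x k ≠ 0 := fun h => hx0 (key x hx h)
  refine ⟨x, hx0, le_antisymm (fun v hv => ?_) ?_⟩
  · rw [LinearMap.mem_ker, Matrix.mulVecLin_apply] at hv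
    refine Submodule.mem_span_singleton.2 ⟨v k / x k, ?_⟩
    have := key (v - (v k / x k) • x) (by rw [Matrix.mulVec_sub, Matrix.mulVec_smul, hv, hx]; simp)
      (by simp [hxk])
    exact (sub_eq_zero.1 this).symm
  · rw [Submodule.span_singleton_le_iff_mem, LinearMap.mem_ker, Matrix.mulVecLin_apply, hx]

theorem ker_vecMulLinear_diagonal_mul {r : ℕ} {K : Matrix (Fin r) (Fin r) ℂ} (hK : K.det ≠ 0)
    {d : Fin r → ℂ} {k : Fin r} (hk : d k = 0) (hd : ∀ j, j ≠ k → d j ≠ 0) :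
    LinearMap.ker (Matrix.diagonal d * K).vecMulLinear = Submodule.span ℂ {Pi.single k 1} := by
  ext v
  rw [LinearMap.mem_ker, Matrix.vecMulLinear_apply, ← Matrix.vecMul_vecMul,
    Submodule.mem_span_singleton]
  constructor
  · intro h
    have h0 := Matrix.eq_zero_of_vecMul_eq_zero hK h
    refine ⟨v k, ?_⟩
    ext j
    by_cases hj : j = k
    · subst hj; simp
    · have := congrFun h0 j
      rw [Matrix.vecMul_diagonal] at this
      simp [hj, (mul_eq_zero.1 this).resolve_right (hd j hj)]
  · rintro ⟨t, rfl⟩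
    have : Matrix.vecMul (t • Pi.single k (1 : ℂ)) (Matrix.diagonal d) = 0 := by
      ext j
      rw [Matrix.vecMul_diagonal]
      by_cases hj : j = k
      · subst hj; simp [hk]
      · simp [hj]
    rw [this, Matrix.zero_vecMul]

/-- Carries the analysis at a zero to its lattice translates: an invertible left factor `B` leaves
the right kernel unchanged. -/
theorem HasAnalyticValueAt.of_translate {r : ℕ} {F : ℂ → Matrix (Fin r) (Fin r) ℂ} {p c : ℂ}
    {A B : Matrix (Fin r) (Fin r) ℂ} (h : HasAnalyticValueAt F p A)
    (hF : ∀ u, F (u + c) = B * F u) : HasAnalyticValueAt F (p + c) (B * A) := by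
  obtain ⟨H, ha, he, rfl⟩ := h
  have hs : Tendsto (fun u => u - c) (𝓝[≠] (p + c)) (𝓝[≠] p) := by
    refine tendsto_nhdsWithin_iff.2 ⟨?_, ?_⟩
    · have : Tendsto (fun u : ℂ => u - c) (𝓝 (p + c)) (𝓝 (p + c - c)) :=
        (continuous_id.sub continuous_const).tendsto _
      rw [add_sub_cancel_right] at this
      exact this.mono_left nhdsWithin_le_nhds
    · filter_upwards [self_mem_nhdsWithin] with u hu hc
      exact hu (by rw [Set.mem_singleton_iff] at hc ⊢; linear_combination hc)
  refine ⟨fun u => B * H (u - c), fun i j => ?_, ?_, by simp⟩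
  · simp only [Matrix.mul_apply]
    refine Finset.analyticAt_fun_sum _ fun k _ => analyticAt_const.mul ?_
    exact (ha k j).comp_of_eq (f := fun u : ℂ => u - c) (by fun_prop) (by ring)
  · filter_upwards [hs.eventually he] with u hu
    rw [← hu, ← hF, sub_add_cancel]

/-! ### Points of the fundamental domain -/

theorem eq_of_mem_fundamentalDomain {τ : ℂ} (hτ : 0 < τ.im) {u v : ℂ}
    (hu : u ∈ fundamentalDomain τ) (hv : v ∈ fundamentalDomain τ)
    (h : ∃ m n : ℤ, u - v = m + n * τ) : u = v := by
  obtain ⟨s, t, hs, ht, rfl⟩ := hu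
  obtain ⟨s', t', hs', ht', rfl⟩ := hv
  obtain ⟨m, n, h⟩ := h
  have him := congrArg Complex.im h
  have hre := congrArg Complex.re h
  simp at him hre
  have h1 : t - t' = n := by
    apply mul_right_cancel₀ hτ.ne'
    linear_combination him
  have hn : n = 0 := by
    have h2 : (n : ℝ) < 1 := by linarith [ht.2, ht'.1]
    have h3 : (-1 : ℝ) < n := by linarith [ht.1, ht'.2]
    have h4 : n < 1 := by exact_mod_cast h2
    have h5 : -1 < n := by exact_mod_cast h3
    omega
  have ht0 : t = t' := by rw [hn] at h1; simpa [sub_eq_zero] using h1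
  have h6 : s - s' = m := by rw [hn, ht0] at hre; simp at hre; linarith
  have hm : m = 0 := by
    have h2 : (m : ℝ) < 1 := by linarith [hs.2, hs'.1]
    have h3 : (-1 : ℝ) < m := by linarith [hs.1, hs'.2]
    have h4 : m < 1 := by exact_mod_cast h2
    have h5 : -1 < m := by exact_mod_cast h3
    omega
  have hs0 : s = s' := by rw [hm] at h6; simpa [sub_eq_zero] using h6
  rw [hs0, ht0]

theorem latticeOrd_sub {τ : ℂ} (hτ : 0 < τ.im) {u v : ℂ} (hu : u ∈ fundamentalDomain τ)
    (hv : v ∈ fundamentalDomain τ) [Decidable (v = u)] :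
    latticeOrd τ (u - v) = if v = u then 1 else 0 := by
  split_ifs with h
  · exact latticeOrd_of_mem ⟨0, 0, by simp [h]⟩
  · exact latticeOrd_of_notMem fun h' => h (eq_of_mem_fundamentalDomain hτ hu hv h').symm

theorem exists_of_latticeOrd_sum_ne_zero {ι : Type*} {s : Finset ι} {τ p : ℂ} {w : ι → ℂ}
    (h : ∑ k ∈ s, latticeOrd τ (p - w k) ≠ 0) :
    ∃ (k : ι) (m n : ℤ), k ∈ s ∧ p = w k + m + n * τ := by
  obtain ⟨k, hk, hne⟩ := Finset.exists_ne_zero_of_sum_ne_zero h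
  by_contra! hc
  refine hne (latticeOrd_of_notMem ?_)
  rintro ⟨m, n, e⟩
  exact hc k m n hk (by linear_combination e)

/-! ### Columns with Jordan automorphy -/

theorem coe_jordanGL (r : ℕ) {α : ℂ} (hα : α ≠ 0) :
    (jordanGL r α hα : Matrix (Fin r) (Fin r) ℂ) = jordanBlock r α := rfl

/-- Columns `c j` (indexed by `j`) of coefficients with Jordan automorphy: under `u ↦ u + τ` the
coefficient of index `l` becomes `α` times itself plus the previous one. -/
structure IsJordanColumns (τ α : ℂ) {r : ℕ} (c : Fin r → ℕ → ℂ → ℂ) : Prop where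
  meromorphic : ∀ (j : Fin r) l, l ≤ (j : ℕ) → Meromorphic (c j l)
  add_one : ∀ (j : Fin r) l, l ≤ (j : ℕ) → ∀ u, c j l (u + 1) = c j l u
  add_tau_zero : ∀ j u, c j 0 (u + τ) = α * c j 0 u
  add_tau_succ : ∀ (j : Fin r) l, l + 1 ≤ (j : ℕ) → ∀ u,
    c j (l + 1) (u + τ) = α * c j (l + 1) u + c j l u

namespace IsJordanColumns

variable {τ α : ℂ} {r : ℕ} {c : Fin r → ℕ → ℂ → ℂ}

theorem isMeromorphicMatrix (hc : IsJordanColumns τ α c) :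
    IsMeromorphicMatrix fun u => upperOf r fun j l => c j l u :=
  isMeromorphicMatrix_upperOf hc.meromorphic

theorem upperOf_add_one (hc : IsJordanColumns τ α c) (u : ℂ) :
    (upperOf r fun j l => c j l (u + 1)) = upperOf r fun j l => c j l u := by
  ext i j
  simp only [upperOf, Matrix.of_apply, hc.add_one j _ (Nat.sub_le _ _)]

theorem upperOf_add_tau (hc : IsJordanColumns τ α c) (u : ℂ) :
    (upperOf r fun j l => c j l (u + τ)) = jordanBlock r α * upperOf r fun j l => c j l u := by
  have h := jordanBlock_mul_upperOf (r := r) (α := α) (β := 1) (c := fun j l => c j l u)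
    (d := fun j l => c j l (u + τ)) (fun j => by rw [one_mul, hc.add_tau_zero])
    (fun j l hl => by rw [one_mul, hc.add_tau_succ j l hl])
  rw [h, one_smul]

theorem upperOf_add_lattice (hc : IsJordanColumns τ α c) (hα : α ≠ 0) (m n : ℤ) (u : ℂ) :
    (upperOf r fun j l => c j l (u + m + n * τ)) =
      ((jordanGL r α hα ^ n : GL (Fin r) ℂ) : Matrix (Fin r) (Fin r) ℂ) *
        upperOf r fun j l => c j l u := by
  have h := apply_add_int_mul_eq_zpow_smul (f := fun u => upperOf r fun j l => c j l u) (c := τ)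
    (g := jordanGL r α hα) (p := fun _ => True) (fun _ => rfl)
    (fun v _ => by rw [Units.smul_def, smul_eq_mul, coe_jordanGL]; exact hc.upperOf_add_tau v)
    (u := u + m) trivial n
  have h1 := apply_add_int_mul_of_periodic
    (f := fun u => upperOf r fun j l => c j l u) hc.upperOf_add_one u m
  rw [mul_one] at h1
  exact h.trans (by rw [h1, Units.smul_def, smul_eq_mul])

theorem isTrivialization (hc : IsJordanColumns τ α c) (hα : α ≠ 0)
    (hnd : IsNondegenerate fun u => upperOf r fun j l => c j l u) :
    IsTrivialization τ (flatFactor (jordanGL r α hα)) fun u => upperOf r fun j l => c j l u :=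
  ⟨hc.isMeromorphicMatrix, hnd, fun m n => Eventually.of_forall fun u =>
    hc.upperOf_add_lattice hα m n u⟩

/-- Take `S = G⁻¹ F`, the inverse being the adjugate because `det G = 1`. From `J G(u) = α G(u + τ)`
and `F(u + τ) = J F(u)` follows `S(u + τ) = α S(u)`. -/
theorem hasFormGS (hc : IsJordanColumns τ α c) (hτ : 0 < τ.im) (hα : α ≠ 0) (a : ℂ)
    (hnd : IsNondegenerate fun u => upperOf r fun j l => c j l u) :
    HasFormGS τ α a fun u => upperOf r fun j l => c j l u := by
  have hinv (u : ℂ) : (GMatrix r τ α a u).adjugate * GMatrix r τ α a u = 1 := by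
    rw [Matrix.adjugate_mul, det_GMatrix, one_smul]
  have hdet (u : ℂ) : (GMatrix r τ α a u).adjugate.det = 1 := by
    have h := congrArg Matrix.det (hinv u)
    rwa [Matrix.det_mul, det_GMatrix, mul_one, Matrix.det_one] at h
  let S : ℂ → Matrix (Fin r) (Fin r) ℂ := fun u =>
    (GMatrix r τ α a u).adjugate * upperOf r fun j l => c j l u
  let p : ℂ → Prop := fun u => theta τ (u - a - 1 / 2 - τ / 2) ≠ 0
  have hp : ∀ u, p (u + τ) = p u := by
    intro u
    have e : u + τ - a - 1 / 2 - τ / 2 = (u - a - 1 / 2 - τ / 2) + τ := by ring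
    have h : theta τ ((u - a - 1 / 2 - τ / 2) + τ) = _ * theta τ (u - a - 1 / 2 - τ / 2) :=
      jacobiTheta₂_add_left' _ τ
    simp only [p]
    rw [e, h]
    simp [Complex.exp_ne_zero]
  have hp1 : ∀ u, p (u + 1) = p u := by
    intro u
    have e : u + 1 - a - 1 / 2 - τ / 2 = (u - a - 1 / 2 - τ / 2) + 1 := by ring
    have h : theta τ ((u - a - 1 / 2 - τ / 2) + 1) = theta τ (u - a - 1 / 2 - τ / 2) :=
      jacobiTheta₂_add_left _ τ
    simp only [p]
    rw [e, h]
  have hS1 : ∀ u, S (u + 1) = S u := by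
    intro u
    simp only [S]
    rw [GMatrix_add_one, hc.upperOf_add_one]
  have hSτ : ∀ u, p u → S (u + τ) = (Units.mk0 α hα) • S u := by
    intro u hu
    have hG := GMatrix_add_tau r (α := α) (a := a) hτ hα hu
    have h2 : GMatrix r τ α a u * S u = upperOf r fun j l => c j l u := by
      simp only [S]
      rw [← mul_assoc, Matrix.mul_adjugate, det_GMatrix, one_smul, one_mul]
    rw [Units.smul_def, Units.val_mk0]
    calc S (u + τ) = (GMatrix r τ α a (u + τ)).adjugate *
          (jordanBlock r α * (GMatrix r τ α a u * S u)) := by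
            simp only [S]; rw [h2, hc.upperOf_add_tau]
      _ = α • S u := by
            rw [← mul_assoc (jordanBlock r α), hG, Matrix.smul_mul, Matrix.mul_smul, ← mul_assoc,
              hinv, one_mul]
  refine ⟨S, (isMeromorphicMatrix_GMatrix r hτ α a).adjugate.mul hc.isMeromorphicMatrix, ?_,
    fun m n => ?_, Eventually.of_forall fun u => ?_⟩
  · intro h
    refine hnd (h.mono fun u hu => ?_)
    rwa [Matrix.det_mul, hdet, one_mul] at hu
  -- The automorphy of `S` is claimed only off the zeros of theta, where that of `λ_a` is available.
  · have hev := eventually_theta_ne_zero hτ (a + 1 / 2 + τ / 2)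
    filter_upwards [hev] with u hu
    have hpu : p u := by
      simp only [p]
      convert hu using 2
      ring
    have hpm : p (u + m) := by
      have := apply_add_int_mul_of_periodic hp1 u m
      rw [mul_one] at this
      rwa [this]
    have h1 := apply_add_int_mul_of_periodic hS1 u m
    rw [mul_one] at h1
    rw [apply_add_int_mul_eq_zpow_smul hp hSτ hpm n, h1, Units.smul_def, Units.val_zpow_eq_zpow_val,
      Units.val_mk0]
  · simp only [S]
    rw [← mul_assoc, Matrix.mul_adjugate, det_GMatrix, one_smul, one_mul]

end IsJordanColumns

/-! ### From columns to null-pole interpolation -/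

theorem meromorphicOrderAt_upperOf_apply {r : ℕ} {c : Fin r → ℕ → ℂ → ℂ} {i j : Fin r} (h : i ≤ j)
    (p : ℂ) : meromorphicOrderAt (fun v => (upperOf r fun j l => c j l v) i j) p =
      meromorphicOrderAt (c j ((j : ℕ) - i)) p := by
  simp only [upperOf, Matrix.of_apply, if_pos h]

theorem meromorphicOrderAt_upperOf_apply_of_lt {r : ℕ} {c : Fin r → ℕ → ℂ → ℂ} {i j : Fin r}
    (h : j < i) (p : ℂ) :
    meromorphicOrderAt (fun v => (upperOf r fun j l => c j l v) i j) p = ⊤ := by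
  simp only [upperOf, Matrix.of_apply, if_neg h.not_ge]
  exact meromorphicOrderAt_eq_top_iff.2 (Eventually.of_forall fun _ => rfl)

/-- If the columns have the prescribed zeros on the diagonal, and simple poles, each of them in a
single column, then they give a matrix interpolating a simple null-pole data set. -/
theorem exists_interpolates_of_columns {τ α : ℂ} (hτ : 0 < τ.im) (hα : α ≠ 0) (a : ℂ) {r N : ℕ}
    {z w : Fin N → ℂ} (hz : ∀ k, z k ∈ fundamentalDomain τ) (hw : ∀ k, w k ∈ fundamentalDomain τ)
    (hzw : Function.Injective (Sum.elim z w)) (col : Fin N → Fin r) {c : Fin r → ℕ → ℂ → ℂ}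
    (hc : IsJordanColumns τ α c)
    (hzero : ∀ j p, meromorphicOrderAt (c j 0) p =
      ((∑ k with col k = j, latticeOrd τ (p - z k) - ∑ k with col k = j, latticeOrd τ (p - w k) :
        ℤ) : WithTop ℤ))
    (hpole : ∀ (j : Fin r) l, l ≤ (j : ℕ) → ∀ p,
      ((-∑ k with col k = j, latticeOrd τ (p - w k) : ℤ) : WithTop ℤ) ≤
        meromorphicOrderAt (c j l) p) :
    ∃ (D : SimpleNullPoleData τ r N) (F : ℂ → Matrix (Fin r) (Fin r) ℂ),
      IsTrivialization τ (flatFactor (jordanGL r α hα)) F ∧ HasFormGS τ α a F ∧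
        Interpolates F D := by
  classical
  set F : ℂ → Matrix (Fin r) (Fin r) ℂ := fun u => upperOf r fun j l => c j l u with hF
  have hdet (p : ℂ) : meromorphicOrderAt (fun v => (F v).det) p =
      ((∑ k, latticeOrd τ (p - z k) - ∑ k, latticeOrd τ (p - w k) : ℤ) : WithTop ℤ) := by
    simp only [hF, det_upperOf]
    rw [meromorphicOrderAt_fun_prod fun j _ => hc.meromorphic j 0 (Nat.zero_le _) p]
    simp only [hzero]
    rw [← WithTop.coe_sum, Finset.sum_sub_distrib, Finset.sum_fiberwise, Finset.sum_fiberwise]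
  have hnd : IsNondegenerate F := by
    intro h
    have h1 : meromorphicOrderAt (fun v => (F v).det) 0 = ⊤ := by
      rw [meromorphicOrderAt_eq_top_iff]
      have h2 := disjoint_principal_right.1 (mem_codiscrete.1 h 0)
      rwa [compl_compl] at h2
    rw [hdet] at h1
    exact WithTop.coe_ne_top h1
  -- values of the lattice indicator at the points of the data set
  have hmem : ∀ x, Sum.elim z w x ∈ fundamentalDomain τ := by
    rintro (k | k)
    exacts [hz k, hw k]
  have hval (x y : Fin N ⊕ Fin N) (m n : ℤ) :
      latticeOrd τ (Sum.elim z w x + m + n * τ - Sum.elim z w y) = if y = x then 1 else 0 := by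
    have e : Sum.elim z w x + m + n * τ - Sum.elim z w y =
      Sum.elim z w x - Sum.elim z w y + m + n * τ := by ring
    rw [e, latticeOrd_add, latticeOrd_sub hτ (hmem x) (hmem y)]
    simp only [hzw.eq_iff]
  have hzz (k k' : Fin N) (m n : ℤ) :
      latticeOrd τ (z k + m + n * τ - z k') = if k' = k then 1 else 0 := by
    simpa using hval (Sum.inl k) (Sum.inl k') m n
  have hzw' (k k' : Fin N) (m n : ℤ) : latticeOrd τ (z k + m + n * τ - w k') = 0 := by
    simpa using hval (Sum.inl k) (Sum.inr k') m n
  have hwz (k k' : Fin N) (m n : ℤ) : latticeOrd τ (w k + m + n * τ - z k') = 0 := by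
    simpa using hval (Sum.inr k) (Sum.inl k') m n
  have hww (k k' : Fin N) (m n : ℤ) :
      latticeOrd τ (w k + m + n * τ - w k') = if k' = k then 1 else 0 := by
    simpa using hval (Sum.inr k) (Sum.inr k') m n
  have hsum (k : Fin N) (j : Fin r) : (∑ k' with col k' = j, if k' = k then (1 : ℤ) else 0) =
      if j = col k then 1 else 0 := by
    rw [Finset.sum_ite_eq']
    simp [eq_comm]
  have hmer (i j : Fin r) (p : ℂ) : MeromorphicAt (fun v => F v i j) p :=
    hc.isMeromorphicMatrix i j p
  have hright (k : Fin N) : ∃ (x : Fin r → ℂ) (A : Matrix (Fin r) (Fin r) ℂ), x ≠ 0 ∧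
      HasAnalyticValueAt F (z k) A ∧ LinearMap.ker A.mulVecLin = Submodule.span ℂ {x} := by
    have hord0 (j : Fin r) : meromorphicOrderAt (c j 0) (z k) =
        ((if j = col k then 1 else 0 : ℤ) : WithTop ℤ) := by
      rw [hzero]
      have h1 := fun k' => hzz k k' 0 0
      have h2 := fun k' => hzw' k k' 0 0
      simp only [Int.cast_zero, zero_mul, add_zero] at h1 h2
      simp only [h1, h2, hsum, Finset.sum_const_zero, sub_zero]
    have hord (i j : Fin r) : 0 ≤ meromorphicOrderAt (fun v => F v i j) (z k) := by
      rcases le_or_gt i j with hij | hij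
      · rw [meromorphicOrderAt_upperOf_apply hij]
        have h := hpole j (j - i) (Nat.sub_le _ _) (z k)
        have h2 := fun k' => hzw' k k' 0 0
        simp only [Int.cast_zero, zero_mul, add_zero] at h2
        simp only [h2, Finset.sum_const_zero, neg_zero] at h
        exact h
      · rw [meromorphicOrderAt_upperOf_apply_of_lt hij]
        exact le_top
    obtain ⟨H, hH, hFH⟩ := exists_analyticAt_matrix (hmer · · (z k)) hord
    have hHord (i j : Fin r) : meromorphicOrderAt (fun v => H v i j) (z k) =
        meromorphicOrderAt (fun v => F v i j) (z k) :=
      (meromorphicOrderAt_congr (hFH.mono fun u hu => by simp only [hu])).symm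
    have hne (i j : Fin r) := meromorphicOrderAt_eq_zero_iff_ne_zero (hH i j)
    have hdiag (j : Fin r) : meromorphicOrderAt (fun v => H v j j) (z k) =
        ((if j = col k then 1 else 0 : ℤ) : WithTop ℤ) := by
      rw [hHord, meromorphicOrderAt_upperOf_apply le_rfl, Nat.sub_self, hord0]
    -- The analytic extension is still triangular at `z k`: entries below the diagonal have order
    -- `⊤`, hence value zero. On the diagonal only column `col k` has positive order.
    obtain ⟨x, hx0, hx⟩ := exists_ker_mulVecLin_eq_span (A := H (z k)) (k := col k)
      (fun i j hij => by
        by_contra h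
        have := (hne i j).2 h
        rw [hHord, meromorphicOrderAt_upperOf_apply_of_lt hij] at this
        exact absurd this (by simp))
      (by
        by_contra h
        have := (hne _ _).2 h
        rw [hdiag, if_pos rfl] at this
        exact absurd this (by simp))
      (fun j hj => (hne j j).1 (by rw [hdiag, if_neg hj]; rfl))
    exact ⟨x, H (z k), hx0, ⟨H, hH, hFH, rfl⟩, hx⟩
  choose x A hx0 hA hkerA using hright
  refine ⟨⟨z, w, x, fun k => Pi.single (col k) 1, hz, hw, hzw, hx0, fun k => by simp⟩, F,
    hc.isTrivialization hα hnd, hc.hasFormGS hτ hα a hnd, ⟨?_, ?_, ?_, ?_⟩⟩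
  · intro u hu
    rw [hdet]
    congr 2
    · simp only [latticeOrd_sub hτ hu (hz _)]
      rw [Nat.card_eq_fintype_card, Fintype.card_subtype]
      simp
    · simp only [latticeOrd_sub hτ hu (hw _)]
      rw [Nat.card_eq_fintype_card, Fintype.card_subtype]
      simp
  · intro i j p hp
    have hij : i ≤ j := by
      by_contra h
      rw [meromorphicOrderAt_upperOf_apply_of_lt (not_le.1 h)] at hp
      exact absurd hp (by simp)
    rw [meromorphicOrderAt_upperOf_apply hij] at hp ⊢
    have hle := hpole j (j - i) (Nat.sub_le _ _) p
    have hne : ∑ k with col k = j, latticeOrd τ (p - w k) ≠ 0 := by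
      intro h
      rw [h] at hle
      exact absurd (hle.trans_lt hp) (by simp)
    obtain ⟨k, m, n, hk, rfl⟩ := exists_of_latticeOrd_sum_ne_zero hne
    refine ⟨?_, k, m, n, rfl⟩
    simp only [hww, hsum] at hle
    rw [if_pos (Finset.mem_filter.1 hk).2.symm] at hle
    exact hle
  · intro k m n
    have hFm (u : ℂ) : F (u + (m + n * τ)) =
        ((jordanGL r α hα ^ n : GL (Fin r) ℂ) : Matrix (Fin r) (Fin r) ℂ) * F u := by
      rw [← add_assoc]; exact hc.upperOf_add_lattice hα m n u
    refine ⟨((jordanGL r α hα ^ n : GL (Fin r) ℂ) : Matrix (Fin r) (Fin r) ℂ) * A k, ?_, ?_⟩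
    · rw [add_assoc]
      exact (hA k).of_translate hFm
    · rw [← hkerA k]
      ext v
      rw [LinearMap.mem_ker, LinearMap.mem_ker, Matrix.mulVecLin_apply, Matrix.mulVecLin_apply,
        ← Matrix.mulVec_mulVec]
      constructor
      · intro h
        have h' := congrArg
          (((jordanGL r α hα ^ n)⁻¹ : GL (Fin r) ℂ) : Matrix (Fin r) (Fin r) ℂ).mulVec h
        rwa [Matrix.mulVec_mulVec, Units.inv_mul, Matrix.one_mulVec, Matrix.mulVec_zero] at h'
      · intro h
        rw [h, Matrix.mulVec_zero]
  · intro k m n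
    simp only
    set p := w k + m + n * τ with hp
    -- All poles at `p` lie in column `col k`, so right multiplication by `diagonal d` clears them.
    -- With `H` the analytic extension of the product, `F⁻¹ = diagonal d * H⁻¹` near `p`.
    let d : ℂ → Fin r → ℂ := fun u j => if j = col k then u - p else 1
    have hd (j : Fin r) : AnalyticAt ℂ (fun u => d u j) p := by
      simp only [d]
      split_ifs <;> fun_prop
    have hdord (j : Fin r) : meromorphicOrderAt (fun u => d u j) p =
        ((if j = col k then 1 else 0 : ℤ) : WithTop ℤ) := by
      simp only [d]
      split_ifs with h
      · exact meromorphicOrderAt_id_sub_const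
      · exact (meromorphicOrderAt_eq_zero_iff_ne_zero analyticAt_const).2 one_ne_zero
    have hentry (i j : Fin r) : (fun u => (F u * Matrix.diagonal (d u)) i j) =
        fun u => F u i j * d u j := by
      ext u; rw [Matrix.mul_diagonal]
    have hmer' (i j : Fin r) : MeromorphicAt (fun u => (F u * Matrix.diagonal (d u)) i j) p := by
      rw [hentry]; exact (hmer i j p).fun_mul (hd j).meromorphicAt
    have hord' (i j : Fin r) :
        meromorphicOrderAt (fun u => (F u * Matrix.diagonal (d u)) i j) p =
          meromorphicOrderAt (fun u => F u i j) p +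
            ((if j = col k then 1 else 0 : ℤ) : WithTop ℤ) := by
      rw [hentry, ← hdord]; exact fun_meromorphicOrderAt_mul (hmer i j p) (hd j).meromorphicAt
    have hord (i j : Fin r) :
        0 ≤ meromorphicOrderAt (fun u => (F u * Matrix.diagonal (d u)) i j) p := by
      rw [hord']
      rcases le_or_gt i j with hij | hij
      · rw [meromorphicOrderAt_upperOf_apply hij]
        have h := hpole j (j - i) (Nat.sub_le _ _) p
        simp only [hp, hww, hsum] at h
        calc (0 : WithTop ℤ) = ((-(if j = col k then 1 else 0) : ℤ) : WithTop ℤ) +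
            ((if j = col k then 1 else 0 : ℤ) : WithTop ℤ) := by
              rw [← WithTop.coe_add, neg_add_cancel]; rfl
          _ ≤ _ := by gcongr
      · rw [meromorphicOrderAt_upperOf_apply_of_lt hij]
        exact le_top
    obtain ⟨H, hH, hFH⟩ := exists_analyticAt_matrix hmer' hord
    have hHord (i j : Fin r) : meromorphicOrderAt (fun v => H v i j) p = _ :=
      (meromorphicOrderAt_congr (hFH.mono fun u hu => by simp only [hu])).symm.trans (hord' i j)
    have hne (i j : Fin r) := meromorphicOrderAt_eq_zero_iff_ne_zero (hH i j)
    -- The diagonal orders all become zero: `-1 + 1` in column `col k`, and `0 + 0` elsewhere, since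
    -- no zero of the data set is congruent to `p`.
    have hdetH : (H p).det ≠ 0 := by
      rw [Matrix.det_of_isUpperTriangular fun i j (hij : j < i) => by
        by_contra h
        have := (hne i j).2 h
        rw [hHord, meromorphicOrderAt_upperOf_apply_of_lt hij] at this
        exact absurd this (by simp)]
      refine Finset.prod_ne_zero_iff.2 fun j _ => (hne j j).1 ?_
      rw [hHord, meromorphicOrderAt_upperOf_apply le_rfl, Nat.sub_self, hzero, ← WithTop.coe_add]
      simp only [hp, hww, hwz, hsum, Finset.sum_const_zero, zero_sub, neg_add_cancel]
      rfl
    refine ⟨Matrix.diagonal (d p) * (H p)⁻¹, ⟨fun u => Matrix.diagonal (d u) * (H u)⁻¹,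
      fun i j => ?_, ?_, rfl⟩, ?_⟩
    · simp only [Matrix.diagonal_mul]
      exact (hd i).mul (analyticAt_inv hH hdetH i j)
    · filter_upwards [hFH, self_mem_nhdsWithin] with u hu hup
      have hdu : IsUnit (Matrix.diagonal (d u)).det := by
        rw [Matrix.det_diagonal, isUnit_iff_ne_zero]
        refine Finset.prod_ne_zero_iff.2 fun j _ => ?_
        simp only [d]
        split_ifs
        · exact sub_ne_zero.2 hup
        · exact one_ne_zero
      rw [← hu, Matrix.mul_inv_rev, ← mul_assoc, Matrix.mul_nonsing_inv _ hdu, one_mul]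
    · refine ker_vecMulLinear_diagonal_mul ?_ (by simp [d]) fun j hj => by simp [d, hj]
      rw [Matrix.det_nonsing_inv, Ring.inverse_eq_inv']
      exact inv_ne_zero hdetH

/-! ### Entire functions with Jordan automorphy -/

/-- The functions `p_l(-(1 / 2 π i) d/du)` applied to `u ↦ sigmaFun τ (u - b)`, where `p_l` is
`pPoly α l`. -/
noncomputable def jordanCoeff (τ α b : ℂ) : ℕ → ℂ → ℂ
  | 0 => fun u => sigmaFun τ (u - b)
  | l + 1 => fun u => (-(2 * Real.pi * Complex.I)⁻¹ * deriv (jordanCoeff τ α b l) u -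
      l * jordanCoeff τ α b l u) / (α * (l + 1))

theorem differentiable_jordanCoeff {τ : ℂ} (hτ : 0 < τ.im) (α b : ℂ) (l : ℕ) :
    Differentiable ℂ (jordanCoeff τ α b l) := by
  induction l with
  | zero => exact (differentiable_sigmaFun hτ).comp (by fun_prop : Differentiable ℂ fun u => u - b)
  | succ l ih =>
    have h : Differentiable ℂ (deriv (jordanCoeff τ α b l)) := fun u =>
      (ih.analyticAt u).deriv.differentiableAt
    unfold jordanCoeff
    fun_prop

theorem jordanCoeff_add_one (τ α b : ℂ) (l : ℕ) (u : ℂ) :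
    jordanCoeff τ α b l (u + 1) = jordanCoeff τ α b l u := by
  induction l generalizing u with
  | zero =>
    simp only [jordanCoeff]
    rw [show u + 1 - b = u - b + 1 by ring, sigmaFun_add_one]
  | succ l ih =>
    have h : deriv (jordanCoeff τ α b l) (u + 1) = deriv (jordanCoeff τ α b l) u := by
      rw [← deriv_comp_add_const]; congr 1; ext w; exact ih w
    simp only [jordanCoeff, ih, h]

theorem jordanCoeff_zero_add_tau {τ α : ℂ} (hτ : 0 < τ.im) (hα : α ≠ 0) (b u : ℂ) :
    jordanCoeff τ α b 0 (u + τ) = -Complex.exp (-(2 * Real.pi * Complex.I * (u - b))) / α *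
      (α * jordanCoeff τ α b 0 u) := by
  simp only [jordanCoeff]
  rw [show u + τ - b = u - b + τ by ring, sigmaFun_add_tau hτ]
  field_simp

/-- In terms of `D = -(2πi)⁻¹ d/du`, passing the multiplier changes `D` into `D + 1`. -/
theorem deriv_eq_of_add_tau {τ α b : ℂ} {g k : ℂ → ℂ} (hk : Differentiable ℂ k)
    (h : ∀ u, g (u + τ) = -Complex.exp (-(2 * Real.pi * Complex.I * (u - b))) / α * k u) (u : ℂ) :
    deriv g (u + τ) = -Complex.exp (-(2 * Real.pi * Complex.I * (u - b))) / α *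
      (deriv k u - 2 * Real.pi * Complex.I * k u) := by
  rw [← deriv_comp_add_const, funext h]
  have h1 : HasDerivAt (fun u : ℂ => -(2 * Real.pi * Complex.I * (u - b)))
      (-(2 * Real.pi * Complex.I)) u := by
    simpa using (((hasDerivAt_id u).sub_const b).const_mul (2 * Real.pi * Complex.I)).fun_neg
  rw [((h1.cexp.fun_neg.div_const α).fun_mul (hk u).hasDerivAt).deriv]
  ring

/-- Formally this is `α p_{l+1}(D + 1) = α p_{l+1}(D) + p_l(D)` applied to the shifted `sigmaFun`.
The induction differentiates the previous identity and uses the recursion, solved for the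
derivative, to return to the coefficients. -/
theorem jordanCoeff_succ_add_tau {τ α : ℂ} (hτ : 0 < τ.im) (hα : α ≠ 0) (b : ℂ) (l : ℕ) (u : ℂ) :
    jordanCoeff τ α b (l + 1) (u + τ) = -Complex.exp (-(2 * Real.pi * Complex.I * (u - b))) / α *
      (α * jordanCoeff τ α b (l + 1) u + jordanCoeff τ α b l u) := by
  have hd := differentiable_jordanCoeff hτ α b
  have hp := Complex.two_pi_I_ne_zero
  have hderiv (l : ℕ) (u : ℂ) : deriv (jordanCoeff τ α b l) u = -(2 * Real.pi * Complex.I) *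
      (α * (l + 1) * jordanCoeff τ α b (l + 1) u + l * jordanCoeff τ α b l u) := by
    have h1 : (l : ℂ) + 1 ≠ 0 := Nat.cast_add_one_ne_zero l
    simp only [jordanCoeff]
    field_simp
    ring
  have hE := Complex.exp_ne_zero (-(2 * Real.pi * Complex.I * (u - b)))
  induction l generalizing u with
  | zero =>
    have hk : Differentiable ℂ fun u => α * jordanCoeff τ α b 0 u := (hd 0).const_mul α
    have h := deriv_eq_of_add_tau hk (jordanCoeff_zero_add_tau hτ hα b) u
    rw [hderiv, deriv_const_mul _ (hd 0 u), hderiv] at h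
    push_cast at h
    refine mul_left_cancel₀ (mul_ne_zero hα hp) ?_
    linear_combination -h
  | succ l ih =>
    have h2 : (l : ℂ) + 1 + 1 ≠ 0 := by exact_mod_cast Nat.succ_ne_zero (l + 1)
    have hk : Differentiable ℂ fun u => α * jordanCoeff τ α b (l + 1) u + jordanCoeff τ α b l u :=
      ((hd _).const_mul α).add (hd l)
    have h := deriv_eq_of_add_tau hk (fun u => ih u (Complex.exp_ne_zero _)) u
    rw [hderiv, deriv_fun_add ((hd _).const_mul α u) (hd l u), deriv_const_mul _ (hd _ u), hderiv,
      hderiv, ih u hE] at h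
    push_cast at h
    refine mul_left_cancel₀ (mul_ne_zero (mul_ne_zero hα hp) h2) ?_
    linear_combination -h

theorem meromorphicOrderAt_sigmaFun_sub {τ : ℂ} (hτ : 0 < τ.im) (b p : ℂ) :
    meromorphicOrderAt (fun u => sigmaFun τ (u - b)) p = (latticeOrd τ (p - b) : WithTop ℤ) := by
  rw [meromorphicOrderAt_fun_comp_sub_const_eq_meromorphicOrderAt, meromorphicOrderAt_sigmaFun hτ]

theorem meromorphic_sigmaFun_sub {τ : ℂ} (hτ : 0 < τ.im) (b : ℂ) :
    Meromorphic fun u => sigmaFun τ (u - b) := fun p =>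
  (((differentiable_sigmaFun hτ).comp
    (by fun_prop : Differentiable ℂ fun u => u - b)).analyticAt p).meromorphicAt

theorem sigmaFun_add_tau_sub {τ : ℂ} (hτ : 0 < τ.im) (u b : ℂ) :
    sigmaFun τ (u + τ - b) =
      -Complex.exp (-(2 * Real.pi * Complex.I * (u - b))) * sigmaFun τ (u - b) := by
  rw [show u + τ - b = u - b + τ by ring, sigmaFun_add_tau hτ]

theorem sigmaFun_add_one_sub (τ u b : ℂ) : sigmaFun τ (u + 1 - b) = sigmaFun τ (u - b) := by
  rw [show u + 1 - b = u - b + 1 by ring, sigmaFun_add_one]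

/-! ### Points -/

theorem exists_add_mem_fundamentalDomain {τ : ℂ} (hτ : 0 < τ.im) (u : ℂ) :
    ∃ v ∈ fundamentalDomain τ, ∃ m n : ℤ, v = u + m + n * τ := by
  set t : ℝ := u.im / τ.im with ht
  set s : ℝ := u.re - t * τ.re with hs
  refine ⟨Int.fract s + Int.fract t * τ, ⟨Int.fract s, Int.fract t, ⟨Int.fract_nonneg _,
    Int.fract_lt_one _⟩, ⟨Int.fract_nonneg _, Int.fract_lt_one _⟩, rfl⟩, -⌊s⌋, -⌊t⌋, ?_⟩
  have hu : u = s + t * τ := by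
    apply Complex.ext
    · simp [hs]
    · simp [ht, hτ.ne']
  rw [← Int.self_sub_floor, ← Int.self_sub_floor]
  push_cast
  linear_combination -hu

/-- In the real basis `1, τ` some coordinate of `x` is not an integer; take for `e` the other basis
vector. Poles placed along `e` then never meet their translates by `-x` modulo the lattice. -/
theorem exists_direction {τ x : ℂ} (hτ : 0 < τ.im) (hx : ¬ ∃ m n : ℤ, x = m + n * τ) :
    ∃ e : ℂ, (e = 1 ∨ e = τ) ∧ ∀ (ρ : ℝ) (m n : ℤ), x ≠ ρ * e + m + n * τ := by
  by_contra! hc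
  obtain ⟨ρ, m, n, h1⟩ := hc 1 (Or.inl rfl)
  obtain ⟨ρ', m', n', h2⟩ := hc τ (Or.inr rfl)
  have him := congrArg Complex.im (h1.symm.trans h2)
  have hre := congrArg Complex.re (h1.symm.trans h2)
  simp at him hre
  have h3 : (n : ℝ) = ρ' + n' := mul_right_cancel₀ hτ.ne' (by linear_combination him)
  have h4 : ρ = ((m' - m : ℤ) : ℝ) := by push_cast; rw [h3] at hre; linear_combination hre
  refine hx ⟨m', n, ?_⟩
  rw [h1, h4]
  push_cast
  ring

theorem div_mul_mem_fundamentalDomain {τ e : ℂ} (he : e = 1 ∨ e = τ) {k N : ℕ} (hk : k < N) :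
    (((k : ℝ) / N : ℝ) : ℂ) * e ∈ fundamentalDomain τ := by
  have hN : (0 : ℝ) < N := by exact_mod_cast (Nat.zero_le k).trans_lt hk
  have h : (k : ℝ) / N ∈ Set.Ico (0 : ℝ) 1 :=
    ⟨by positivity, by rw [div_lt_one hN]; exact_mod_cast hk⟩
  rcases he with rfl | rfl
  · exact ⟨_, 0, h, by simp, by simp⟩
  · exact ⟨0, _, by simp, h, by simp⟩

theorem natCast_div_injective {N k k' : ℕ} (hN : N ≠ 0) (h : (k : ℝ) / N = (k' : ℝ) / N) :
    k = k' := by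
  have hN' : (N : ℝ) ≠ 0 := by exact_mod_cast hN
  rw [div_left_inj' hN'] at h
  exact_mod_cast h

/-! ### Scalar compensating factors -/

/-- The multiplier of `h` compensates that of `jordanCoeff τ α b`, so that their products have
Jordan automorphy. -/
structure IsCompensator (τ α b : ℂ) (h : ℂ → ℂ) : Prop where
  meromorphic : Meromorphic h
  add_one : ∀ u, h (u + 1) = h u
  add_tau : ∀ u, -Complex.exp (-(2 * Real.pi * Complex.I * (u - b))) / α * h (u + τ) = h u

namespace IsCompensator

variable {τ α b : ℂ} {h : ℂ → ℂ}

theorem meromorphic_mul (hh : IsCompensator τ α b h) (hτ : 0 < τ.im) (l : ℕ) :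
    Meromorphic fun u => jordanCoeff τ α b l u * h u := fun p =>
  ((differentiable_jordanCoeff hτ α b l).analyticAt p).meromorphicAt.fun_mul (hh.meromorphic p)

theorem mul_add_one (hh : IsCompensator τ α b h) (l : ℕ) (u : ℂ) :
    jordanCoeff τ α b l (u + 1) * h (u + 1) = jordanCoeff τ α b l u * h u := by
  rw [jordanCoeff_add_one, hh.add_one]

theorem mul_add_tau_zero (hh : IsCompensator τ α b h) (hτ : 0 < τ.im) (hα : α ≠ 0) (u : ℂ) :
    jordanCoeff τ α b 0 (u + τ) * h (u + τ) = α * (jordanCoeff τ α b 0 u * h u) := by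
  rw [jordanCoeff_zero_add_tau hτ hα]
  linear_combination α * jordanCoeff τ α b 0 u * hh.add_tau u

theorem mul_add_tau_succ (hh : IsCompensator τ α b h) (hτ : 0 < τ.im) (hα : α ≠ 0) (l : ℕ)
    (u : ℂ) : jordanCoeff τ α b (l + 1) (u + τ) * h (u + τ) =
      α * (jordanCoeff τ α b (l + 1) u * h u) + jordanCoeff τ α b l u * h u := by
  rw [jordanCoeff_succ_add_tau hτ hα]
  linear_combination (α * jordanCoeff τ α b (l + 1) u + jordanCoeff τ α b l u) * hh.add_tau u

theorem meromorphicOrderAt_le_mul (hh : IsCompensator τ α b h) (hτ : 0 < τ.im) (l : ℕ) (p : ℂ) :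
    meromorphicOrderAt h p ≤ meromorphicOrderAt (fun u => jordanCoeff τ α b l u * h u) p := by
  have hg := (differentiable_jordanCoeff hτ α b l).analyticAt p
  rw [fun_meromorphicOrderAt_mul hg.meromorphicAt (hh.meromorphic p)]
  exact le_add_of_nonneg_left hg.meromorphicOrderAt_nonneg

theorem meromorphicOrderAt_mul_zero (hh : IsCompensator τ α b h) (hτ : 0 < τ.im) (p : ℂ) :
    meromorphicOrderAt (fun u => jordanCoeff τ α b 0 u * h u) p =
      (latticeOrd τ (p - b) : WithTop ℤ) + meromorphicOrderAt h p := by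
  rw [fun_meromorphicOrderAt_mul
    ((differentiable_jordanCoeff hτ α b 0).analyticAt p).meromorphicAt (hh.meromorphic p)]
  congr 1
  exact meromorphicOrderAt_sigmaFun_sub hτ b p

end IsCompensator

/-- The quotient of `sigmaFun` translated to `b` and to `w` has multiplier `exp(2πi(b - w))`, which
forces `b = w - x`. -/
theorem isCompensator_inv_sigmaFun {τ x : ℂ} (hτ : 0 < τ.im) (w : ℂ) :
    IsCompensator τ (Complex.exp (-(2 * Real.pi * Complex.I * x))) (w - x)
      fun u => (sigmaFun τ (u - w))⁻¹ where
  meromorphic := (meromorphic_sigmaFun_sub hτ w).inv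
  add_one u := by rw [sigmaFun_add_one_sub]
  add_tau u := by
    have e : Complex.exp (-(2 * Real.pi * Complex.I * (u - (w - x)))) =
        Complex.exp (-(2 * Real.pi * Complex.I * (u - w))) *
          Complex.exp (-(2 * Real.pi * Complex.I * x)) := by
      rw [← Complex.exp_add]; ring_nf
    have h1 := Complex.exp_ne_zero (-(2 * Real.pi * Complex.I * (u - w)))
    have h2 := Complex.exp_ne_zero (-(2 * Real.pi * Complex.I * x))
    rw [sigmaFun_add_tau_sub hτ, e, mul_inv, ← neg_mul, mul_div_cancel_right₀ _ h2, ← mul_assoc,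
      mul_inv_cancel₀ (neg_ne_zero.2 h1), one_mul]

/-- The zeros `b` and `w' + c` of the diagonal entry exceed the poles `w` and `w'` in sum by `kτ`,
giving the multiplier `exp(2πikτ)`. The free offset `c` keeps zeros and poles apart. -/
theorem isCompensator_two_poles {τ : ℂ} (hτ : 0 < τ.im) (k : ℤ) (w w' c : ℂ) :
    IsCompensator τ (Complex.exp (2 * Real.pi * Complex.I * k * τ)) (w - c + k * τ)
      fun u => sigmaFun τ (u - (w' + c)) * (sigmaFun τ (u - w))⁻¹ * (sigmaFun τ (u - w'))⁻¹ where
  meromorphic := ((meromorphic_sigmaFun_sub hτ (w' + c)).fun_mul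
    (meromorphic_sigmaFun_sub hτ w).fun_inv).fun_mul (meromorphic_sigmaFun_sub hτ w').fun_inv
  add_one u := by simp only [sigmaFun_add_one_sub]
  add_tau u := by
    have e : Complex.exp (-(2 * Real.pi * Complex.I * (u - (w - c + k * τ)))) *
        Complex.exp (-(2 * Real.pi * Complex.I * (u - (w' + c)))) =
        Complex.exp (-(2 * Real.pi * Complex.I * (u - w))) *
        Complex.exp (-(2 * Real.pi * Complex.I * (u - w'))) *
          Complex.exp (2 * Real.pi * Complex.I * k * τ) := by
      simp only [← Complex.exp_add]; ring_nf
    have h1 := Complex.exp_ne_zero (-(2 * Real.pi * Complex.I * (u - w)))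
    have h2 := Complex.exp_ne_zero (-(2 * Real.pi * Complex.I * (u - w')))
    have h3 := Complex.exp_ne_zero (2 * Real.pi * Complex.I * k * τ)
    simp only [sigmaFun_add_tau_sub hτ, mul_inv, inv_neg]
    field_simp
    linear_combination (sigmaFun τ (u - (w' + c)) * (sigmaFun τ (u - w))⁻¹ *
      (sigmaFun τ (u - w'))⁻¹) * e

/-! ### The two constructions -/

/-- If `α` is not of the form `exp (2 π i k τ)`, then there is an interpolating trivialization with
`r` zeros and `r` poles. -/
theorem exists_interpolates_generic {τ α : ℂ} (hτ : 0 < τ.im) (hα : α ≠ 0) (a : ℂ) (r : ℕ)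
    (hgen : ¬ ∃ k : ℤ, α = Complex.exp (2 * Real.pi * Complex.I * k * τ)) :
    ∃ (D : SimpleNullPoleData τ r r) (F : ℂ → Matrix (Fin r) (Fin r) ℂ),
      IsTrivialization τ (flatFactor (jordanGL r α hα)) F ∧ HasFormGS τ α a F ∧
        Interpolates F D := by
  obtain ⟨x, rfl⟩ : ∃ x, α = Complex.exp (-(2 * Real.pi * Complex.I * x)) := by
    refine ⟨-(2 * Real.pi * Complex.I)⁻¹ * Complex.log α, ?_⟩
    have := Complex.two_pi_I_ne_zero
    rw [neg_mul, mul_neg, neg_neg, mul_inv_cancel_left₀ this, Complex.exp_log hα]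
  have hx : ¬ ∃ m n : ℤ, x = m + n * τ := by
    rintro ⟨m, n, rfl⟩
    refine hgen ⟨-n, ?_⟩
    rw [Complex.exp_eq_exp_iff_exists_int]
    exact ⟨-m, by push_cast; ring⟩
  obtain ⟨e, he, hxe⟩ := exists_direction hτ hx
  have he0 : e ≠ 0 := by
    rcases he with rfl | rfl
    · exact one_ne_zero
    · rintro rfl; simp at hτ
  let ρ : Fin r → ℝ := fun j => ((j : ℕ) : ℝ) / r
  let w : Fin r → ℂ := fun j => (ρ j : ℂ) * e
  have hw (j : Fin r) : w j ∈ fundamentalDomain τ := div_mul_mem_fundamentalDomain he j.2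
  have hwinj : Function.Injective w := by
    intro i j hij
    have h1 : ρ i = ρ j := by exact_mod_cast mul_right_cancel₀ he0 hij
    exact Fin.ext (natCast_div_injective (by have := i.2; omega) h1)
  -- The zero of column `j` is at `w j - x`, which need not lie in the fundamental domain; `z j` is
  -- its representative there.
  choose z hz m n hzw using fun j => exists_add_mem_fundamentalDomain hτ (w j - x)
  have hzlat (j : Fin r) (p : ℂ) : latticeOrd τ (p - (w j - x)) = latticeOrd τ (p - z j) := by
    rw [← latticeOrd_add τ (p - z j) (m j) (n j), hzw]
    congr 1; ring
  have hzw_ne (i j : Fin r) : z i ≠ w j := by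
    intro h
    refine hxe (ρ i - ρ j) (m i) (n i) ?_
    rw [hzw] at h
    simp only [w] at h
    push_cast
    linear_combination -h
  have hzinj : Function.Injective z := by
    intro i j hij
    rw [hzw, hzw] at hij
    refine hwinj (eq_of_mem_fundamentalDomain hτ (hw i) (hw j) ⟨m j - m i, n j - n i, ?_⟩)
    push_cast
    linear_combination hij
  have hinj : Function.Injective (Sum.elim z w) := hzinj.sumElim hwinj hzw_ne
  have hcomp (j : Fin r) := isCompensator_inv_sigmaFun (x := x) hτ (w j)
  have hord (j : Fin r) (p : ℂ) : meromorphicOrderAt (fun u => (sigmaFun τ (u - w j))⁻¹) p =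
      ((-latticeOrd τ (p - w j) : ℤ) : WithTop ℤ) := by
    rw [fun_meromorphicOrderAt_inv, meromorphicOrderAt_sigmaFun_sub hτ]; rfl
  refine exists_interpolates_of_columns hτ hα a hz hw hinj id
    (c := fun j l u => jordanCoeff τ (Complex.exp (-(2 * Real.pi * Complex.I * x))) (w j - x) l u *
      (sigmaFun τ (u - w j))⁻¹)
    ⟨fun j l _ => (hcomp j).meromorphic_mul hτ l, fun j l _ => (hcomp j).mul_add_one l,
      fun j => (hcomp j).mul_add_tau_zero hτ hα, fun j l _ => (hcomp j).mul_add_tau_succ hτ hα l⟩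
    (fun j p => ?_) fun j l _ p => ?_
  · rw [(hcomp j).meromorphicOrderAt_mul_zero hτ, hord, ← WithTop.coe_add, hzlat]
    simp [Finset.filter_eq', sub_eq_add_neg]
  · refine le_trans (le_of_eq ?_) ((hcomp j).meromorphicOrderAt_le_mul hτ l p)
    rw [hord]
    simp [Finset.filter_eq']

/-- If `α = exp (2 π i k τ)`, then there is an interpolating trivialization with `2 (r - 1)` zeros
and `2 (r - 1)` poles. -/
theorem exists_interpolates_special {τ : ℂ} (hτ : 0 < τ.im) (k : ℤ) (a : ℂ) {r : ℕ} (hr : 1 ≤ r)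
    (hα : Complex.exp (2 * Real.pi * Complex.I * k * τ) ≠ 0) :
    ∃ (D : SimpleNullPoleData τ r (2 * (r - 1))) (F : ℂ → Matrix (Fin r) (Fin r) ℂ),
      IsTrivialization τ (flatFactor (jordanGL r _ hα)) F ∧
        HasFormGS τ (Complex.exp (2 * Real.pi * Complex.I * k * τ)) a F ∧
        Interpolates F D := by
  set α := Complex.exp (2 * Real.pi * Complex.I * k * τ) with hαdef
  set N := 2 * (r - 1) with hN
  let w' : ℕ → ℂ := fun i => (((i : ℝ) / N : ℝ) : ℂ)
  let w : Fin N → ℂ := fun i => w' i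
  let z : Fin N → ℂ := fun i => w' i + τ / 2
  -- Column `j ≥ 1` receives the indices `2(j - 1)` and `2(j - 1) + 1`; column `0` receives none.
  let col : Fin N → Fin r := fun i => ⟨(i : ℕ) / 2 + 1, by have := i.2; omega⟩
  have hdom {i : ℕ} (hi : i < N) : (i : ℝ) / N ∈ Set.Ico (0 : ℝ) 1 := by
    have hN : (0 : ℝ) < N := by exact_mod_cast (Nat.zero_le i).trans_lt hi
    exact ⟨by positivity, by rw [div_lt_one hN]; exact_mod_cast hi⟩
  have hw (i : Fin N) : w i ∈ fundamentalDomain τ := ⟨_, 0, hdom i.2, by simp, by simp [w, w']⟩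
  have hz (i : Fin N) : z i ∈ fundamentalDomain τ :=
    ⟨_, 1 / 2, hdom i.2, by norm_num, by simp [z, w']; ring⟩
  have hwinj : Function.Injective w := by
    intro i j hij
    exact Fin.ext (natCast_div_injective (by have := i.2; omega) (Complex.ofReal_injective hij))
  have hzinj : Function.Injective z := fun i j hij => hwinj (add_right_cancel hij)
  have hzw_ne (i j : Fin N) : z i ≠ w j := by
    intro h
    have him := congrArg Complex.im h
    simp [z, w, w'] at him
    exact hτ.ne' him
  have hinj : Function.Injective (Sum.elim z w) := hzinj.sumElim hwinj hzw_ne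
  have hcol0 (j : Fin r) (hj : (j : ℕ) = 0) : Finset.univ.filter (fun i => col i = j) = ∅ := by
    refine Finset.filter_eq_empty_iff.2 fun i _ h => ?_
    have := congrArg Fin.val h
    simp [col] at this
    omega
  have hsum (j : Fin r) (hj : (j : ℕ) ≠ 0) (f : ℂ → ℤ) :
      ∑ i with col i = j, f (w' i) = f (w' (2 * (j - 1))) + f (w' (2 * (j - 1) + 1)) := by
    have hjr := j.2
    have h1 : 2 * ((j : ℕ) - 1) < N := by omega
    have h2 : 2 * ((j : ℕ) - 1) + 1 < N := by omega
    have : Finset.univ.filter (fun i => col i = j) = {⟨_, h1⟩, ⟨_, h2⟩} := by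
      ext i
      simp only [Finset.mem_filter, Finset.mem_univ, true_and, Finset.mem_insert,
        Finset.mem_singleton, Fin.ext_iff, col]
      omega
    rw [this, Finset.sum_pair (by simp [Fin.ext_iff])]
  let h : Fin r → ℂ → ℂ := fun j u => sigmaFun τ (u - (w' (2 * (j - 1) + 1) + τ / 2)) *
    (sigmaFun τ (u - w' (2 * (j - 1))))⁻¹ * (sigmaFun τ (u - w' (2 * (j - 1) + 1)))⁻¹
  let b : Fin r → ℂ := fun j => w' (2 * (j - 1)) - τ / 2 + k * τ
  have hcomp (j : Fin r) : IsCompensator τ α (b j) (h j) :=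
    isCompensator_two_poles hτ k (w' (2 * (j - 1))) (w' (2 * (j - 1) + 1)) (τ / 2)
  have hord (j : Fin r) (p : ℂ) : meromorphicOrderAt (h j) p =
      ((latticeOrd τ (p - (w' (2 * (j - 1) + 1) + τ / 2)) - latticeOrd τ (p - w' (2 * (j - 1))) -
        latticeOrd τ (p - w' (2 * (j - 1) + 1)) : ℤ) : WithTop ℤ) := by
    have h1 := meromorphic_sigmaFun_sub hτ (w' (2 * (j - 1) + 1) + τ / 2) p
    have h2 := (meromorphic_sigmaFun_sub hτ (w' (2 * (j - 1))) p).fun_inv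
    have h3 := (meromorphic_sigmaFun_sub hτ (w' (2 * (j - 1) + 1)) p).fun_inv
    simp only [h]
    rw [fun_meromorphicOrderAt_mul (h1.fun_mul h2) h3, fun_meromorphicOrderAt_mul h1 h2,
      fun_meromorphicOrderAt_inv, fun_meromorphicOrderAt_inv, meromorphicOrderAt_sigmaFun_sub hτ,
      meromorphicOrderAt_sigmaFun_sub hτ, meromorphicOrderAt_sigmaFun_sub hτ]
    rfl
  have hblat (j : Fin r) (p : ℂ) :
      latticeOrd τ (p - b j) = latticeOrd τ (p - (w' (2 * (j - 1)) + τ / 2)) := by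
    -- The point `b j` differs from the wanted zero, which carries offset `+τ/2`, by `(k - 1)τ`.
    rw [← latticeOrd_add τ (p - b j) 0 (k - 1)]
    congr 1
    simp only [b]
    push_cast
    ring
  let E : ℂ → ℂ := fun u => Complex.exp (2 * Real.pi * Complex.I * k * u)
  have hE : Differentiable ℂ E := by fun_prop
  have hE0 (p : ℂ) : meromorphicOrderAt E p = 0 :=
    (meromorphicOrderAt_eq_zero_iff_ne_zero (hE.analyticAt p)).2 (Complex.exp_ne_zero _)
  -- In column `0` only `l = 0` occurs, so the scalar automorphy of `E` suffices and the successor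
  -- relation is vacuous. For `r = 1` the data set is empty and `E` is the whole matrix.
  let c : Fin r → ℕ → ℂ → ℂ := fun j l =>
    if (j : ℕ) = 0 then E else fun u => jordanCoeff τ α (b j) l u * h j u
  have hc0 (j : Fin r) (l : ℕ) (hj : (j : ℕ) = 0) : c j l = E := if_pos hj
  have hc1 (j : Fin r) (l : ℕ) (hj : (j : ℕ) ≠ 0) :
      c j l = fun u => jordanCoeff τ α (b j) l u * h j u := if_neg hj
  have hc : IsJordanColumns τ α c := by
    refine ⟨fun j l _ => ?_, fun j l _ u => ?_, fun j u => ?_, fun j l hl u => ?_⟩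
    · by_cases hj : (j : ℕ) = 0
      · rw [hc0 j l hj]; exact fun p => (hE.analyticAt p).meromorphicAt
      · rw [hc1 j l hj]; exact (hcomp j).meromorphic_mul hτ l
    · by_cases hj : (j : ℕ) = 0
      · rw [hc0 j l hj]
        exact Complex.exp_eq_exp_iff_exists_int.2 ⟨k, by ring⟩
      · rw [hc1 j l hj]; exact (hcomp j).mul_add_one l u
    · by_cases hj : (j : ℕ) = 0
      · rw [hc0 j 0 hj]
        simp only [E, hαdef]
        rw [← Complex.exp_add]; ring_nf
      · rw [hc1 j 0 hj]; exact (hcomp j).mul_add_tau_zero hτ hα u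
    · have hj : (j : ℕ) ≠ 0 := by omega
      rw [hc1 j l hj, hc1 j (l + 1) hj]; exact (hcomp j).mul_add_tau_succ hτ hα l u
  refine exists_interpolates_of_columns hτ hα a hz hw hinj col hc (fun j p => ?_)
    fun j l _ p => ?_
  · by_cases hj : (j : ℕ) = 0
    · rw [hc0 j 0 hj, hE0, hcol0 j hj]; rfl
    · rw [hc1 j 0 hj, (hcomp j).meromorphicOrderAt_mul_zero hτ, hord, ← WithTop.coe_add, hblat,
        hsum j hj fun y => latticeOrd τ (p - (y + τ / 2)), hsum j hj fun y => latticeOrd τ (p - y)]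
      congr 1
      ring
  · by_cases hj : (j : ℕ) = 0
    · rw [hc0 j l hj, hE0, hcol0 j hj]; rfl
    · rw [hc1 j l hj]
      refine le_trans ?_ ((hcomp j).meromorphicOrderAt_le_mul hτ l p)
      rw [hord, hsum j hj fun y => latticeOrd τ (p - y), WithTop.coe_le_coe]
      -- The extra zero of `h` can only raise the order, so it is dropped from the pole bound.
      linarith [latticeOrd_nonneg τ (p - (w' (2 * (j - 1) + 1) + τ / 2))]

end EllipticNullPole

theorem mainTheorem5 (τ : ℂ) (hτ : 0 < τ.im) (α : ℂ) (hα : α ≠ 0) (a : ℂ)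
    (r : ℕ) (hr : 1 ≤ r) :
    ((∃ k : ℤ, α = Complex.exp (2 * Real.pi * Complex.I * k * τ)) →
      ∃ (D : EllipticNullPole.SimpleNullPoleData τ r (2 * (r - 1)))
        (F : ℂ → Matrix (Fin r) (Fin r) ℂ),
        EllipticNullPole.IsTrivialization τ
          (EllipticNullPole.flatFactor (EllipticNullPole.jordanGL r α hα)) F ∧
        EllipticNullPole.HasFormGS τ α a F ∧
        EllipticNullPole.Interpolates F D) ∧
    ((¬ ∃ k : ℤ, α = Complex.exp (2 * Real.pi * Complex.I * k * τ)) →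
      ∃ (D : EllipticNullPole.SimpleNullPoleData τ r r)
        (F : ℂ → Matrix (Fin r) (Fin r) ℂ),
        EllipticNullPole.IsTrivialization τ
          (EllipticNullPole.flatFactor (EllipticNullPole.jordanGL r α hα)) F ∧
        EllipticNullPole.HasFormGS τ α a F ∧
        EllipticNullPole.Interpolates F D) := by

  refine ⟨?_, EllipticNullPole.exists_interpolates_generic hτ hα a r⟩
  rintro ⟨k, rfl⟩
  exact EllipticNullPole.exists_interpolates_special hτ k a hr hα
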